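/- **Setting.** An instance of online concave diminishing-returns allocation (OCDRA) consists of items $1,\dots,n$ arriving in this order, pairwise disjoint finite sets $A_1,\dots,A_n$ of options, and an objective $f:\mathbb{R}_{\ge 0}^{A}\to\mathbb{R}_{\ge 0}$, where $A=\bigcup_j A_j$, such that - $f(0)=0$, and $f$ is concave and monotone non-decreasing; - $f$ is upward-differentiable: for every $x\in\mathbb{R}_{\ge0}^A$ there is a vector $\nabla f(x)\in\mathbb{R}^A$ with $\lim_{\epsilon\to0^+}\frac{f(x+\epsilon y)-f(x)}{\epsilon}=\langle\nabla f(x),y\rangle$ for every $y\in\mathbb{R}_{\ge0}^A$; - $\nabla f$ is coordinatewise non-increasing: $x\le y$ implies $\nabla f(y)\le\nabla f(x)$. An allocation $x\in\mathbb{R}_{\ge0}^A$ is feasible if $\sum_{a\in A_j}x_a\le1$ for every $j$. A (deterministic, fractional) online algorithm must irrevocably fix $(x_a)_{a\in A_j}$ when item $j$ arrives, knowing only $A_1,\dots,A_j$ and the restriction of $f$ to $A_1\cup\dots\cup A_j$ (all other coordinates set to $0$). It is $\gamma$-competitive if on every instance its final allocation $x$ is feasible and $f(x)\ge\gamma f(y)$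 for every feasible $y$. Let $U(x)=\frac1{e-1}\int_0^1e^t\,t\,f(x/t)\,dt$. Continuous greedy with respect to $U$ starts at $x=0$ and processes the items in order. For item $j$ (if $A_j\ne\emptyset$), $x$ moves during one unit of time along an absolutely continuous path whose rate vector is, at almost every time, nonnegative, of total mass $1$, and supported on the options $a\in A_j$ that maximize $\partial U(x)/\partial x_a$ over $A_j$. If $A_j=\emptyset$, nothing is allocated for item $j$. **Theorem 1.** There is a $(1-\frac1e)$-competitive online algorithm for OCDRA; moreover it can be chosen so that on every instance its final allocation is an outcome of continuous greedy with respect to $U$. Furthermore, on every instance, every outcome $x$ of continuous greedy with respect to $U$ is feasible and satisfies $f(x)\ge(1-\frac1e)f(y)$ for every feasible $y$. -/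

import Mathlib

open scoped NNReal

namespace OCDRA

/-- `g` is the upward-gradient of `F` at the point `x` of the nonnegative orthant: it gives the
one-sided directional derivatives of `F` at `x` in all nonnegative directions. -/
def IsUpwardGradient {ι : Type*} [Fintype ι] (F : (ι → ℝ≥0) → ℝ) (x : ι → ℝ≥0) (g : ι → ℝ) :
    Prop :=
  ∀ y : ι → ℝ≥0,
    Filter.Tendsto (fun ε : ℝ≥0 => (F (x + ε • y) - F x) / (ε : ℝ))
      (nhdsWithin 0 (Set.Ioi 0)) (nhds (∑ a, g a * (y a : ℝ)))

/-- Concave diminishing-returns valuations on the nonnegative orthant. -/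
structure IsCDR {ι : Type*} [Fintype ι] (f : (ι → ℝ≥0) → ℝ≥0) : Prop where
  map_zero : f 0 = 0
  concave : ConcaveOn ℝ≥0 Set.univ f
  mono : Monotone f
  upward_differentiable :
    ∀ x, ∃ g : ι → ℝ, IsUpwardGradient (fun z => (f z : ℝ)) x g
  diminishing_returns :
    ∀ (x y : ι → ℝ≥0) (g h : ι → ℝ), x ≤ y →
      IsUpwardGradient (fun z => (f z : ℝ)) x g →
      IsUpwardGradient (fun z => (f z : ℝ)) y h → ∀ a, h a ≤ g a

/-- The auxiliary function `U(x) = 1/(e-1) ∫₀¹ eᵗ t f(x/t) dt`. -/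
noncomputable def auxiliary {ι : Type*} (f : (ι → ℝ≥0) → ℝ≥0) (x : ι → ℝ≥0) : ℝ :=
  1 / (Real.exp 1 - 1) *
    ∫ t in (0 : ℝ)..1, Real.exp t * (t * (f ((Real.toNNReal t)⁻¹ • x) : ℝ))

/-- The raw data of an allocation problem with option labels in `α`: a number of items, the
finite option set of every item, and an objective on the nonnegative vectors indexed by the union
of the option sets. The information revealed to an online algorithm is again of this form. -/
structure Data (α : Type*) [DecidableEq α] where
  /-- the number of items -/
  n : ℕ
  /-- the options of each item, in the order of arrival -/
  options : Fin n → Finset α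
  /-- the objective -/
  f : ({a // a ∈ Finset.univ.biUnion options} → ℝ≥0) → ℝ≥0

namespace Data

variable {α : Type*} [DecidableEq α]

/-- The union of all option sets, as a type. -/
abbrev Opt (I : Data α) : Type _ := {a // a ∈ Finset.univ.biUnion I.options}

/-- `I` is an instance of online concave diminishing-returns allocation. -/
structure IsOCDRA (I : Data α) : Prop where
  disjoint : ∀ i j : Fin I.n, i ≠ j → Disjoint (I.options i) (I.options j)
  cdr : IsCDR I.f

/-- The options of item `j`, as a set of coordinates. -/
def optionSet (I : Data α) (j : Fin I.n) : Finset I.Opt :=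
  Finset.univ.filter fun a => a.1 ∈ I.options j

/-- What has been revealed when item `j` has arrived: the option sets of the items up to and
including `j`, and the objective restricted to these options, that is, with all the other
coordinates set to zero. -/
def reveal (I : Data α) (j : Fin I.n) : Data α where
  n := j.1 + 1
  options := fun i => I.options (Fin.castLE j.2 i)
  f := fun x => I.f fun a =>
    if h : a.1 ∈ Finset.univ.biUnion (fun i : Fin (j.1 + 1) => I.options (Fin.castLE j.2 i))
    then x ⟨a.1, h⟩ else 0

/-- Feasible allocations: at most one unit of every item is allocated. -/
def IsFeasible (I : Data α) (x : I.Opt → ℝ≥0) : Prop :=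
  ∀ j : Fin I.n, ∑ a ∈ I.optionSet j, x a ≤ 1

/-- The part of the allocation `x` made before the arrival of item `j`. -/
noncomputable def before (I : Data α) (j : Fin I.n) (x : I.Opt → ℝ≥0) : I.Opt → ℝ≥0 :=
  Set.indicator {a | ∃ i : Fin I.n, i < j ∧ a ∈ I.optionSet i} x

/-- The part of the allocation `x` made up to and including item `j`. -/
noncomputable def upTo (I : Data α) (j : Fin I.n) (x : I.Opt → ℝ≥0) : I.Opt → ℝ≥0 :=
  Set.indicator {a | ∃ i : Fin I.n, i ≤ j ∧ a ∈ I.optionSet i} x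

end Data

/-- The options in `S` whose partial derivative of `U` at `x` is largest among those in `S`. -/
def greedyChoices {ι : Type*} [Fintype ι] (U : (ι → ℝ≥0) → ℝ) (S : Finset ι) (x : ι → ℝ≥0) :
    Set ι :=
  {a | a ∈ S ∧ ∃ g : ι → ℝ, IsUpwardGradient U x g ∧ ∀ b ∈ S, g b ≤ g a}

/-- During one unit of time the vector moves from `x₀` to `x₁` along a path `z` with rates `r`,
where at almost every time the rates are a unit of mass split among the options in `S` that
maximize the current partial derivative of `U` (no mass at all if `S` is empty). -/
def IsGreedyPhase {ι : Type*} [Fintype ι] (U : (ι → ℝ≥0) → ℝ) (S : Finset ι)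
    (x₀ x₁ : ι → ℝ≥0) : Prop :=
  ∃ (z : ℝ → ι → ℝ≥0) (r : ℝ → ι → ℝ),
    z 0 = x₀ ∧ z 1 = x₁ ∧
    (∀ a, IntervalIntegrable (fun s => r s a) MeasureTheory.volume 0 1) ∧
    (∀ t ∈ Set.Icc (0 : ℝ) 1, ∀ a, (z t a : ℝ) = (x₀ a : ℝ) + ∫ s in (0 : ℝ)..t, r s a) ∧
    (∀ᵐ s ∂(MeasureTheory.volume.restrict (Set.Icc (0 : ℝ) 1)),
      (∀ a, 0 ≤ r s a) ∧
      (S.Nonempty → ∑ a ∈ S, r s a = 1) ∧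
      (∀ a, r s a ≠ 0 → a ∈ greedyChoices U S (z s)))

/-- `x` is a possible final allocation of continuous greedy with respect to `U` on `I`. -/
def IsContinuousGreedyOutput {α : Type*} [DecidableEq α] (I : Data α)
    (U : (I.Opt → ℝ≥0) → ℝ) (x : I.Opt → ℝ≥0) : Prop :=
  ∀ j : Fin I.n, IsGreedyPhase U (I.optionSet j) (I.before j x) (I.upTo j x)

/-- A deterministic fractional online algorithm: from the information revealed so far it computes
the amounts allocated through the options of the item that has just arrived. -/
abbrev OnlineAlgorithm (α : Type*) [DecidableEq α] : Type _ := Data α → α → ℝ≥0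

namespace OnlineAlgorithm

variable {α : Type*} [DecidableEq α]

/-- The final allocation of the algorithm on `I`. The option sets of an instance are disjoint, so
for every option only the summand of its own item is present. -/
def output (alg : OnlineAlgorithm α) (I : Data α) : I.Opt → ℝ≥0 :=
  fun a => ∑ j : Fin I.n, if a ∈ I.optionSet j then alg (I.reveal j) a.1 else 0

/-- On every instance the algorithm produces a feasible allocation of value at least `γ` times
the value of every feasible allocation. -/
def IsCompetitive (alg : OnlineAlgorithm α) (γ : ℝ) : Prop :=
  ∀ I : Data α, I.IsOCDRA →
    I.IsFeasible (alg.output I) ∧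
    ∀ y : I.Opt → ℝ≥0, I.IsFeasible y → γ * (I.f y : ℝ) ≤ (I.f (alg.output I) : ℝ)

end OnlineAlgorithm

end OCDRA

/-! Two inequalities about the potential `U` give the ratio. First, for all `x` and `y`, `⟨∇U(x), y⟩
≥ f(y) + U(x) - e/(e-1) f(x)` (`le_sum_averagedGrad`). The perspective `t f(x/t)` is concave and
homogeneous, hence superadditive in `(x, t)`, so its value at `(x + hy, t)` is at least its value at
`(x, t - h)` plus `h f(y)`. Integrated against `e^t`, the shift by `h` produces the factor `e^h`,
which is the source of the term `U(x)`; the part of the integral pushed beyond `t = 1` costs the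
term in `f(x)`.

Second, if `x` is a greedy outcome and `y` is feasible, then `⟨∇U(x), y⟩ ≤ U(x)`
(`IsContinuousGreedyOutput.sum_le`). While an item is processed, `U` grows at the rate of the
largest current partial derivative. As `∇U` is non-increasing, this is at least the largest one at
the final `x`, and so dominates any split of the item; the phases telescope from `U(0) = 0`.
Together, `f(y) ≤ e/(e-1) f(x)`.

Greedy phases exist because averaging makes `∇U` continuous even where `∇f` jumps: limits of Euler
schemes are Lipschitz paths that follow maximizing options. The algorithm is online because the
revealed objective is `f` composed with extension by zero, so a phase on the revealed data is a
phase on the full instance. -/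

open Filter Topology MeasureTheory

namespace OCDRA

/-! ### One-sided calculus of concave functions on the orthant -/

section Calculus

variable {ι : Type*} [Fintype ι] {F : (ι → ℝ≥0) → ℝ} {x y : ι → ℝ≥0} {g h : ι → ℝ}

instance nhdsGT_zero_neBot : (𝓝[>] (0 : ℝ≥0)).NeBot := nhdsGT_neBot 0

lemma IsUpwardGradient.tendsto_single [DecidableEq ι] (hg : IsUpwardGradient F x g) (a : ι) :
    Tendsto (fun ε : ℝ≥0 => (F (x + ε • Pi.single a 1) - F x) / (ε : ℝ)) (𝓝[>] 0) (𝓝 (g a)) := by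
  have := hg (Pi.single a 1)
  convert this using 2
  rw [Finset.sum_eq_single a] <;> simp +contextual

lemma IsUpwardGradient.unique (hg : IsUpwardGradient F x g) (hh : IsUpwardGradient F x h) :
    g = h := by
  classical
  funext a
  exact tendsto_nhds_unique (hg.tendsto_single a) (hh.tendsto_single a)

lemma IsUpwardGradient.nonneg (hg : IsUpwardGradient F x g) (hF : Monotone F) (a : ι) :
    0 ≤ g a := by
  classical
  refine ge_of_tendsto (hg.tendsto_single a) (Eventually.of_forall fun ε => ?_)
  exact div_nonneg (sub_nonneg.2 (hF le_self_add)) ε.2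

omit [Fintype ι] in
lemma sub_le_slope_of_concave (hF : ConcaveOn ℝ≥0 Set.univ F) (x y : ι → ℝ≥0) {ε : ℝ≥0}
    (h₀ : 0 < ε) (h₁ : ε ≤ 1) : F (x + y) - F x ≤ (F (x + ε • y) - F x) / ε := by
  have h := hF.2 (Set.mem_univ x) (Set.mem_univ (x + y)) zero_le zero_le
    (tsub_add_cancel_of_le h₁)
  have e : (1 - ε) • x + ε • (x + y) = x + ε • y := by
    rw [smul_add, ← add_assoc, ← add_smul, tsub_add_cancel_of_le h₁, one_smul]
  rw [e] at h
  simp only [NNReal.smul_def, smul_eq_mul, NNReal.coe_sub h₁, NNReal.coe_one] at h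
  have h₀' : (0 : ℝ) < ε := h₀
  rw [le_div_iff₀ h₀']
  linarith

lemma IsUpwardGradient.sub_le (hg : IsUpwardGradient F x g) (hF : ConcaveOn ℝ≥0 Set.univ F)
    (y : ι → ℝ≥0) : F (x + y) - F x ≤ ∑ a, g a * (y a : ℝ) := by
  refine ge_of_tendsto (hg y) ?_
  filter_upwards [Ioc_mem_nhdsGT (zero_lt_one' ℝ≥0)] with ε hε
  exact sub_le_slope_of_concave hF x y hε.1 hε.2

/-- The gradient at the upper endpoint bounds the increment from below. It only sees upward
directions, so the comparison with the lower point `x` goes through concavity on the segment from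
`x` to `x + y + εy`. -/
lemma IsUpwardGradient.le_sub (hg : IsUpwardGradient F (x + y) g)
    (hF : ConcaveOn ℝ≥0 Set.univ F) : ∑ a, g a * (y a : ℝ) ≤ F (x + y) - F x := by
  refine le_of_tendsto (hg y) ?_
  filter_upwards [self_mem_nhdsWithin] with ε hε
  have hε' : (0 : ℝ) < ε := hε
  rw [div_le_iff₀ hε']
  -- These weights express `x + y` as a convex combination of `x + y + εy` and `x`.
  have hsum : 1 / (1 + ε) + ε / (1 + ε) = 1 := by
    rw [← add_div, div_self (by positivity)]
  have h := hF.2 (Set.mem_univ (x + y + ε • y)) (Set.mem_univ x) zero_le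
    zero_le hsum
  have e : (1 / (1 + ε)) • (x + y + ε • y) + (ε / (1 + ε)) • x = x + y := by
    funext a
    simp only [Pi.add_apply, Pi.smul_apply, smul_eq_mul]
    have : (1 + ε) ≠ 0 := by positivity
    field_simp
    ring
  rw [e] at h
  simp only [NNReal.smul_def, smul_eq_mul, NNReal.coe_div, NNReal.coe_add, NNReal.coe_one] at h
  have h1 : (0 : ℝ) < 1 + ε := by positivity
  rw [div_mul_eq_mul_div, div_mul_eq_mul_div, ← add_div, div_le_iff₀ h1] at h
  linarith

end Calculus

/-- A monotone concave function on the nonnegative orthant together with its upward gradient,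
which is coordinatewise non-increasing. -/
structure HasAntitoneGradient {ι : Type*} [Fintype ι] (F : (ι → ℝ≥0) → ℝ)
    (G : (ι → ℝ≥0) → ι → ℝ) : Prop where
  concave : ConcaveOn ℝ≥0 Set.univ F
  mono : Monotone F
  grad : ∀ x, IsUpwardGradient F x (G x)
  antitone : Antitone G

namespace HasAntitoneGradient

variable {ι : Type*} [Fintype ι] {F : (ι → ℝ≥0) → ℝ} {G : (ι → ℝ≥0) → ι → ℝ}

lemma nonneg (h : HasAntitoneGradient F G) (x : ι → ℝ≥0) (a : ι) : 0 ≤ G x a :=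
  (h.grad x).nonneg h.mono a

lemma le_zero (h : HasAntitoneGradient F G) (x : ι → ℝ≥0) (a : ι) : G x a ≤ G 0 a :=
  h.antitone zero_le a

lemma add_le (h : HasAntitoneGradient F G) (x y : ι → ℝ≥0) :
    F (x + y) ≤ F x + ∑ a, G 0 a * (y a : ℝ) := by
  have h1 := (h.grad x).sub_le h.concave y
  have h2 : ∑ a, G x a * (y a : ℝ) ≤ ∑ a, G 0 a * (y a : ℝ) :=
    Finset.sum_le_sum fun a _ => mul_le_mul_of_nonneg_right (h.le_zero x a) (y a).2
  linarith

/-- Raising `x` by the positive part of `y - x` costs at most the gradient at `0`, the largest one,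
and monotonicity absorbs the coordinates that decrease. This gives a Lipschitz bound valid up to the
boundary of the orthant. -/
lemma le_add_sum_abs (h : HasAntitoneGradient F G) (x y : ι → ℝ≥0) :
    F y ≤ F x + ∑ a, G 0 a * |(y a : ℝ) - x a| := by
  have h1 := h.mono (show y ≤ x + (y - x) from le_add_tsub)
  have h2 := h.add_le x (y - x)
  have h3 : ∑ a, G 0 a * ((y - x) a : ℝ) ≤ ∑ a, G 0 a * |(y a : ℝ) - x a| := by
    refine Finset.sum_le_sum fun a _ => mul_le_mul_of_nonneg_left ?_ (h.nonneg 0 a)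
    rw [Pi.sub_apply, NNReal.coe_sub_def]
    exact max_le (le_abs_self _) (abs_nonneg _)
  linarith

lemma continuous (h : HasAntitoneGradient F G) : Continuous F := by
  refine continuous_iff_continuousAt.2 fun x => ?_
  have key : ∀ y, |F y - F x| ≤ ∑ a, G 0 a * |(y a : ℝ) - x a| := fun y => by
    have h1 := h.le_add_sum_abs x y
    have h2 := h.le_add_sum_abs y x
    simp only [abs_sub_comm (x _ : ℝ)] at h2
    exact abs_le.2 ⟨by linarith, by linarith⟩
  rw [ContinuousAt, tendsto_iff_dist_tendsto_zero]
  refine squeeze_zero (fun _ => dist_nonneg) key ?_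
  have : Continuous fun y : ι → ℝ≥0 => ∑ a, G 0 a * |(y a : ℝ) - x a| := by fun_prop
  have := this.tendsto x
  simpa using this

end HasAntitoneGradient

lemma IsCDR.exists_hasAntitoneGradient {ι : Type*} [Fintype ι] {f : (ι → ℝ≥0) → ℝ≥0}
    (hf : IsCDR f) : ∃ G, HasAntitoneGradient (fun z => (f z : ℝ)) G := by
  choose G hG using hf.upward_differentiable
  refine ⟨G, ⟨convex_univ, fun x hx y hy a b ha hb hab => ?_⟩, fun x y hxy => ?_, hG,
    fun x y hxy => hf.diminishing_returns x y _ _ hxy (hG x) (hG y)⟩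
  · have := hf.concave.2 hx hy ha hb hab
    exact_mod_cast this
  · exact_mod_cast hf.mono hxy

/-! ### The perspective and its exponential average -/

/-- The perspective `t F(x/t)` of `F`, which vanishes for `t ≤ 0`. -/
noncomputable def perspective {ι : Type*} (F : (ι → ℝ≥0) → ℝ) (x : ι → ℝ≥0) (t : ℝ) : ℝ :=
  t * F ((Real.toNNReal t)⁻¹ • x)

/-- The exponentially weighted average of the perspectives of a real function. -/
noncomputable def averaged {ι : Type*} (F : (ι → ℝ≥0) → ℝ) (x : ι → ℝ≥0) : ℝ :=
  1 / (Real.exp 1 - 1) * ∫ t in (0 : ℝ)..1, Real.exp t * perspective F x t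

/-- The gradient of the averaged function. -/
noncomputable def averagedGrad {ι : Type*} (G : (ι → ℝ≥0) → ι → ℝ) (x : ι → ℝ≥0) (a : ι) : ℝ :=
  1 / (Real.exp 1 - 1) * ∫ t in (0 : ℝ)..1, Real.exp t * G ((Real.toNNReal t)⁻¹ • x) a

lemma exp_sub_one_pos : 0 < Real.exp 1 - 1 := by
  have := Real.add_one_lt_exp (one_ne_zero' ℝ)
  linarith

lemma inv_exp_sub_one_nonneg : 0 ≤ 1 / (Real.exp 1 - 1) :=
  one_div_nonneg.2 exp_sub_one_pos.le

section Perspective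

variable {ι : Type*} {F : (ι → ℝ≥0) → ℝ}

lemma perspective_of_nonpos (F : (ι → ℝ≥0) → ℝ) (x : ι → ℝ≥0) {t : ℝ} (ht : t ≤ 0)
    (h0 : F 0 = 0) : perspective F x t = 0 := by
  simp [perspective, Real.toNNReal_of_nonpos ht, h0]

lemma perspective_one (F : (ι → ℝ≥0) → ℝ) (x : ι → ℝ≥0) : perspective F x 1 = F x := by
  simp [perspective]

lemma perspective_zero_left (h0 : F 0 = 0) (t : ℝ) : perspective F 0 t = 0 := by
  simp [perspective, h0]

lemma perspective_coe (F : (ι → ℝ≥0) → ℝ) (x : ι → ℝ≥0) (t : ℝ≥0) :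
    perspective F x t = t * F (t⁻¹ • x) := by
  simp [perspective]

lemma perspective_smul (F : (ι → ℝ≥0) → ℝ) (x : ι → ℝ≥0) (a t : ℝ≥0) :
    perspective F (a • x) ((a * t : ℝ≥0) : ℝ) = a * perspective F x t := by
  rcases eq_or_ne a 0 with rfl | ha
  · simp [perspective]
  · rw [perspective_coe, perspective_coe, smul_smul, mul_inv_rev, mul_assoc, inv_mul_cancel₀ ha,
      mul_one, NNReal.coe_mul, mul_assoc]

lemma perspective_mono_left (hm : Monotone F) {t : ℝ} (ht : 0 ≤ t) :
    Monotone fun x => perspective F x t := fun _ _ hxy =>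
  mul_le_mul_of_nonneg_left (hm (smul_le_smul_of_nonneg_left hxy zero_le)) ht

lemma perspective_nonneg (hm : Monotone F) (h0 : F 0 = 0) (x : ι → ℝ≥0) (t : ℝ) :
    0 ≤ perspective F x t := by
  rcases le_total t 0 with ht | ht
  · exact (perspective_of_nonpos F x ht h0).ge
  · exact mul_nonneg ht (h0 ▸ hm zero_le)

/-- Concavity applied to `x/s` and `y/t` with weights proportional to `s` and `t`. When `s` or `t`
is `0` the inverse is `0` by convention, so that term is a multiple of `F 0 = 0` and monotonicity
suffices. -/
lemma perspective_add_le (hF : ConcaveOn ℝ≥0 Set.univ F) (hm : Monotone F) (h0 : F 0 = 0)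
    (x y : ι → ℝ≥0) (s t : ℝ≥0) :
    perspective F x s + perspective F y t ≤ perspective F (x + y) ((s + t : ℝ≥0) : ℝ) := by
  rcases eq_or_ne s 0 with rfl | hs
  · rw [NNReal.coe_zero, perspective_of_nonpos F x le_rfl h0, zero_add, zero_add]
    exact perspective_mono_left hm t.2 le_add_self
  rcases eq_or_ne t 0 with rfl | ht
  · rw [NNReal.coe_zero, perspective_of_nonpos F y le_rfl h0, add_zero, add_zero]
    exact perspective_mono_left hm s.2 le_self_add
  have hst : s + t ≠ 0 := by positivity
  have h := hF.2 (Set.mem_univ (s⁻¹ • x)) (Set.mem_univ (t⁻¹ • y)) (zero_le (a := s / (s + t)))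
    (zero_le (a := t / (s + t))) (by rw [← add_div, div_self hst])
  have e : (s / (s + t)) • s⁻¹ • x + (t / (s + t)) • t⁻¹ • y = (s + t)⁻¹ • (x + y) := by
    rw [smul_smul, smul_smul, smul_add]
    congr 2 <;> field_simp
  rw [e] at h
  rw [perspective_coe, perspective_coe, perspective_coe]
  have hst' : (0 : ℝ) < ((s + t : ℝ≥0) : ℝ) := by positivity
  simp only [NNReal.smul_def, smul_eq_mul, NNReal.coe_div] at h
  rw [div_mul_eq_mul_div, div_mul_eq_mul_div, ← add_div, div_le_iff₀' hst'] at h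
  exact h

lemma perspective_mono (hF : ConcaveOn ℝ≥0 Set.univ F) (hm : Monotone F) (h0 : F 0 = 0)
    (x : ι → ℝ≥0) : Monotone (perspective F x) := by
  intro s t hst
  rcases le_total s 0 with hs | hs
  · rw [perspective_of_nonpos F x hs h0]
    exact perspective_nonneg hm h0 x t
  lift s to ℝ≥0 using hs
  lift t to ℝ≥0 using s.2.trans hst
  have h := perspective_add_le hF hm h0 x 0 s (t - s)
  rw [perspective_zero_left h0, add_zero, add_zero, add_tsub_cancel_of_le (by exact_mod_cast hst)]
    at h
  exact h

lemma intervalIntegrable_exp_mul_perspective (hF : ConcaveOn ℝ≥0 Set.univ F) (hm : Monotone F)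
    (h0 : F 0 = 0) (x : ι → ℝ≥0) (a b : ℝ) :
    IntervalIntegrable (fun t => Real.exp t * perspective F x t) volume a b :=
  (perspective_mono hF hm h0 x).intervalIntegrable.continuousOn_mul
    Real.continuous_exp.continuousOn

lemma averaged_zero (h0 : F 0 = 0) : averaged F 0 = 0 := by
  simp [averaged, perspective_zero_left h0]

lemma averaged_mono (hF : ConcaveOn ℝ≥0 Set.univ F) (hm : Monotone F) (h0 : F 0 = 0) :
    Monotone (averaged F) := by
  intro x y hxy
  refine mul_le_mul_of_nonneg_left ?_ inv_exp_sub_one_nonneg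
  refine intervalIntegral.integral_mono_on zero_le_one
    (intervalIntegrable_exp_mul_perspective hF hm h0 x 0 1)
    (intervalIntegrable_exp_mul_perspective hF hm h0 y 0 1) fun t ht => ?_
  exact mul_le_mul_of_nonneg_left (perspective_mono_left hm ht.1 hxy) (Real.exp_pos t).le

lemma averaged_concave (hF : ConcaveOn ℝ≥0 Set.univ F) (hm : Monotone F) (h0 : F 0 = 0) :
    ConcaveOn ℝ≥0 Set.univ (averaged F) := by
  refine ⟨convex_univ, fun x _ y _ a b _ _ hab => ?_⟩
  have hi := fun x => intervalIntegrable_exp_mul_perspective hF hm h0 x 0 1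
  have key : (a : ℝ) * (∫ t in (0 : ℝ)..1, Real.exp t * perspective F x t) +
      b * (∫ t in (0 : ℝ)..1, Real.exp t * perspective F y t) ≤
      ∫ t in (0 : ℝ)..1, Real.exp t * perspective F (a • x + b • y) t := by
    rw [← intervalIntegral.integral_const_mul, ← intervalIntegral.integral_const_mul,
      ← intervalIntegral.integral_add ((hi x).const_mul _) ((hi y).const_mul _)]
    refine intervalIntegral.integral_mono_on zero_le_one
      (((hi x).const_mul _).add ((hi y).const_mul _)) (hi _) fun t ht => ?_
    lift t to ℝ≥0 using ht.1
    have h := perspective_add_le hF hm h0 (a • x) (b • y) (a * t) (b * t)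
    rw [perspective_smul, perspective_smul, ← add_mul, hab, one_mul] at h
    have := mul_le_mul_of_nonneg_left h (Real.exp_pos t).le
    linarith
  have := mul_le_mul_of_nonneg_left key inv_exp_sub_one_nonneg
  simp only [NNReal.smul_def, smul_eq_mul, averaged] at this ⊢
  linarith

/-- Superadditivity compares time `t` at `x + h • y` with time `t - h` at `x`, gaining `h F(y)`.
Integrating over `[h, 1]` and substituting yields the factor `exp h` and an integral for `x` missing
`[1 - h, 1]`, which is estimated separately. -/
lemma add_le_averaged_shift (hF : ConcaveOn ℝ≥0 Set.univ F) (hm : Monotone F) (h0 : F 0 = 0)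
    (x y : ι → ℝ≥0) {h : ℝ≥0} (h1 : h ≤ 1) :
    Real.exp h * ((∫ t in (0 : ℝ)..1, Real.exp t * perspective F x t) - h * (Real.exp 1 * F x)) +
      h * F y * (Real.exp 1 - Real.exp h) ≤
      ∫ t in (0 : ℝ)..1, Real.exp t * perspective F (x + h • y) t := by
  have h1' : (h : ℝ) ≤ 1 := h1
  have hi := fun x => intervalIntegrable_exp_mul_perspective hF hm h0 x
  have hpos : 0 ≤ ∫ t in (0 : ℝ)..h, Real.exp t * perspective F (x + h • y) t :=
    intervalIntegral.integral_nonneg h.2 fun t _ =>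
      mul_nonneg (Real.exp_pos t).le (perspective_nonneg hm h0 _ t)
  -- The perspective increases in `t`, so the integrand is at most its value `exp 1 * F x` at `t =
  -- 1`.
  have htail : ∫ t in (1 - h : ℝ)..1, Real.exp t * perspective F x t ≤
      h * (Real.exp 1 * F x) := by
    have : ∫ t in (1 - h : ℝ)..1, Real.exp t * perspective F x t ≤
        ∫ t in (1 - h : ℝ)..1, Real.exp 1 * F x := by
      refine intervalIntegral.integral_mono_on (by linarith [h.2]) (hi x _ _)
        intervalIntegrable_const fun t ht => ?_
      rw [← perspective_one F x]
      exact mul_le_mul (Real.exp_le_exp.2 ht.2) (perspective_mono hF hm h0 x ht.2)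
        (perspective_nonneg hm h0 _ _) (Real.exp_pos _).le
    refine this.trans_eq ?_
    rw [intervalIntegral.integral_const, smul_eq_mul]
    ring
  have hshift : ∫ t in (h : ℝ)..1, Real.exp t * perspective F x (t - h) =
      Real.exp h * ∫ t in (0 : ℝ)..(1 - h), Real.exp t * perspective F x t := by
    rw [← intervalIntegral.integral_const_mul]
    have := intervalIntegral.integral_comp_sub_right (a := (h : ℝ)) (b := 1)
      (fun t => Real.exp h * (Real.exp t * perspective F x t)) (h : ℝ)
    rw [sub_self] at this
    rw [← this]
    congr 1
    funext t
    rw [← mul_assoc, ← Real.exp_add]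
    congr 2
    ring
  have hint : IntervalIntegrable (fun t => Real.exp t * perspective F x (t - h)) volume h 1 := by
    refine IntervalIntegrable.continuousOn_mul ?_ Real.continuous_exp.continuousOn
    refine Monotone.intervalIntegrable fun s t hst => perspective_mono hF hm h0 x ?_
    linarith
  have hexp : IntervalIntegrable (fun t => Real.exp t * (h * F y)) volume h 1 :=
    (Real.continuous_exp.mul continuous_const).intervalIntegrable _ _
  have hmain : (∫ t in (h : ℝ)..1, Real.exp t * perspective F x (t - h)) +
      ∫ t in (h : ℝ)..1, Real.exp t * (h * F y) ≤
      ∫ t in (h : ℝ)..1, Real.exp t * perspective F (x + h • y) t := by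
    rw [← intervalIntegral.integral_add hint hexp]
    refine intervalIntegral.integral_mono_on h1' (hint.add hexp) (hi _ _ _) fun t ht => ?_
    lift t to ℝ≥0 using h.2.trans ht.1
    have hht : h ≤ t := ht.1
    have hk := perspective_add_le hF hm h0 x (h • y) (t - h) h
    have hs := perspective_smul F y h 1
    rw [mul_one, NNReal.coe_one, perspective_one] at hs
    rw [hs, tsub_add_cancel_of_le hht, NNReal.coe_sub hht] at hk
    have := mul_le_mul_of_nonneg_left hk (Real.exp_pos t).le
    linarith
  rw [hshift, intervalIntegral.integral_mul_const, integral_exp] at hmain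
  rw [← intervalIntegral.integral_add_adjacent_intervals (hi (x + h • y) 0 h) (hi _ h 1)]
  have hsplit := intervalIntegral.integral_add_adjacent_intervals (hi x 0 (1 - h)) (hi x (1 - h) 1)
  have := mul_le_mul_of_nonneg_left
    (show (∫ t in (0 : ℝ)..1, Real.exp t * perspective F x t) - h * (Real.exp 1 * F x) ≤
      ∫ t in (0 : ℝ)..(1 - h), Real.exp t * perspective F x t by linarith) (Real.exp_pos h).le
  linarith

end Perspective

/-! ### Gradient of the averaged function -/

namespace HasAntitoneGradient

variable {ι : Type*} [Fintype ι] {F : (ι → ℝ≥0) → ℝ} {G : (ι → ℝ≥0) → ι → ℝ}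

lemma intervalIntegrable_exp_mul (h : HasAntitoneGradient F G) (x : ι → ℝ≥0) (a : ι) {b c : ℝ}
    (hb : 0 ≤ b) (hc : 0 ≤ c) :
    IntervalIntegrable (fun t => Real.exp t * G ((Real.toNNReal t)⁻¹ • x) a) volume b c := by
  refine IntervalIntegrable.continuousOn_mul ?_ Real.continuous_exp.continuousOn
  -- Monotone only for `t > 0`: for `t ≤ 0` the inverse is `0` and the value jumps to `G 0 a`, the
  -- maximum.
  have hmono : MonotoneOn (fun t => G ((Real.toNNReal t)⁻¹ • x) a) (Set.Ioi 0) := by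
    intro s hs t ht hst
    refine h.antitone (smul_le_smul_of_nonneg_right ?_ zero_le) a
    exact inv_anti₀ (Real.toNNReal_pos.2 hs) (Real.toNNReal_le_toNNReal hst)
  have hsub : Set.uIoc b c ⊆ Set.Ioi 0 := fun t ht =>
    lt_of_le_of_lt (le_min hb hc) ht.1
  rw [intervalIntegrable_iff]
  refine IntegrableOn.of_bound (C := G 0 a) (by simp [Set.uIoc]) ?_ ?_
  · exact (aemeasurable_restrict_of_monotoneOn measurableSet_uIoc
      (hmono.mono hsub)).aestronglyMeasurable
  · refine Eventually.of_forall fun t => ?_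
    rw [Real.norm_of_nonneg (h.nonneg _ _)]
    exact h.le_zero _ _

lemma averagedGrad_antitone (h : HasAntitoneGradient F G) : Antitone (averagedGrad G) := by
  intro x y hxy a
  refine mul_le_mul_of_nonneg_left ?_ inv_exp_sub_one_nonneg
  refine intervalIntegral.integral_mono_on zero_le_one
    (h.intervalIntegrable_exp_mul y a le_rfl zero_le_one)
    (h.intervalIntegrable_exp_mul x a le_rfl zero_le_one) fun t _ => ?_
  exact mul_le_mul_of_nonneg_left
    (h.antitone (smul_le_smul_of_nonneg_left hxy zero_le) a) (Real.exp_pos t).le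

/-- Differentiation under the integral. The factor `t` cancels the `1/t` inside `F`, so the
perspective's difference quotient is at most `⟨G 0, y⟩` uniformly in `t`, which supplies the
dominating constant. -/
lemma averaged_grad (h : HasAntitoneGradient F G) (h0 : F 0 = 0) (x : ι → ℝ≥0) :
    IsUpwardGradient (averaged F) x (averagedGrad G x) := by
  intro y
  have hi := fun x => intervalIntegrable_exp_mul_perspective h.concave h.mono h0 x 0 1
  have hiG := fun a => h.intervalIntegrable_exp_mul x a le_rfl zero_le_one
  have hlim : Tendsto (fun ε : ℝ≥0 => ∫ t in (0 : ℝ)..1,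
      (Real.exp t * perspective F (x + ε • y) t - Real.exp t * perspective F x t) / ε) (𝓝[>] 0)
      (𝓝 (∫ t in (0 : ℝ)..1, ∑ a, (Real.exp t * G ((Real.toNNReal t)⁻¹ • x) a) * y a)) := by
    refine intervalIntegral.tendsto_integral_filter_of_dominated_convergence
      (fun _ => Real.exp 1 * ∑ a, G 0 a * (y a : ℝ)) ?_ ?_ intervalIntegrable_const ?_
    · refine Eventually.of_forall fun ε => ?_
      exact (((hi _).sub (hi _)).div_const _).def'.aestronglyMeasurable
    · filter_upwards [self_mem_nhdsWithin] with ε hε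
      have hε' : (0 : ℝ) < ε := hε
      refine Eventually.of_forall fun t ht => ?_
      rw [Set.uIoc_of_le zero_le_one] at ht
      have ht1 := ht.2
      lift t to ℝ≥0 using ht.1.le
      have ht0 : (0 : ℝ) < t := ht.1
      have hm : perspective F x t ≤ perspective F (x + ε • y) t :=
        perspective_mono_left h.mono t.2 le_self_add
      have hb := h.add_le (t⁻¹ • x) ((ε * t⁻¹) • y)
      have hsum : ∑ a, G 0 a * ((((ε * t⁻¹) • y) a : ℝ≥0) : ℝ) =
          (ε / t) * ∑ a, G 0 a * (y a : ℝ) := by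
        rw [Finset.mul_sum]
        refine Finset.sum_congr rfl fun a _ => ?_
        simp only [Pi.smul_apply, smul_eq_mul, NNReal.coe_mul, NNReal.coe_inv]
        ring
      have hvec : t⁻¹ • x + (ε * t⁻¹) • y = t⁻¹ • (x + ε • y) := by
        rw [smul_add, smul_smul, mul_comm ε]
      rw [hsum, hvec] at hb
      have hub : perspective F (x + ε • y) t - perspective F x t ≤
          ε * ∑ a, G 0 a * (y a : ℝ) := by
        rw [perspective_coe, perspective_coe]
        have := mul_le_mul_of_nonneg_left hb t.2
        have e : (t : ℝ) * (ε / t * ∑ a, G 0 a * (y a : ℝ)) = ε * ∑ a, G 0 a * (y a : ℝ) := by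
          field_simp
        rw [mul_add] at this
        change (t : ℝ) * _ ≤ (t : ℝ) * _ + (t : ℝ) * _ at this
        linarith
      rw [← mul_sub, mul_div_assoc, Real.norm_of_nonneg
        (mul_nonneg (Real.exp_pos _).le (div_nonneg (sub_nonneg.2 hm) hε'.le))]
      refine mul_le_mul (Real.exp_le_exp.2 ht1) ?_ (div_nonneg (sub_nonneg.2 hm) hε'.le)
        (Real.exp_pos _).le
      rw [div_le_iff₀' hε']
      exact hub
    · refine Eventually.of_forall fun t ht => ?_
      rw [Set.uIoc_of_le zero_le_one] at ht
      lift t to ℝ≥0 using ht.1.le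
      have ht0 : (0 : ℝ) < t := ht.1
      have hg := (h.grad (t⁻¹ • x) (t⁻¹ • y)).const_mul (Real.exp t * t)
      convert hg using 2 with ε
      · rw [perspective_coe, perspective_coe, smul_add, smul_comm t⁻¹ ε y]
        ring
      · rw [Finset.mul_sum]
        refine Finset.sum_congr rfl fun a _ => ?_
        simp only [Pi.smul_apply, smul_eq_mul, NNReal.coe_mul, NNReal.coe_inv,
          Real.toNNReal_coe]
        field_simp
  have hlim' := hlim.const_mul (1 / (Real.exp 1 - 1))
  convert hlim' using 2 with ε
  · rw [intervalIntegral.integral_div, intervalIntegral.integral_sub (hi _) (hi _)]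
    simp only [averaged]
    ring
  · rw [intervalIntegral.integral_finsetSum fun a _ => (hiG a).mul_const _, Finset.mul_sum]
    refine Finset.sum_congr rfl fun a _ => ?_
    rw [intervalIntegral.integral_mul_const, averagedGrad]
    ring

/-- The averaged function inherits concavity and an antitone gradient. -/
lemma averaged (h : HasAntitoneGradient F G) (h0 : F 0 = 0) :
    HasAntitoneGradient (averaged F) (averagedGrad G) where
  concave := averaged_concave h.concave h.mono h0
  mono := averaged_mono h.concave h.mono h0
  grad := h.averaged_grad h0
  antitone := h.averagedGrad_antitone

/-- The averaged function plus its directional derivative dominate the value of every point up to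
a multiple of the value at the current point. -/
lemma le_sum_averagedGrad (h : HasAntitoneGradient F G) (h0 : F 0 = 0) (x y : ι → ℝ≥0) :
    F y + OCDRA.averaged F x - Real.exp 1 / (Real.exp 1 - 1) * F x ≤
      ∑ a, averagedGrad G x a * (y a : ℝ) := by
  set J := ∫ t in (0 : ℝ)..1, Real.exp t * perspective F x t with hJ
  have hJ0 : 0 ≤ J := intervalIntegral.integral_nonneg zero_le_one fun t _ =>
      mul_nonneg (Real.exp_pos t).le (perspective_nonneg h.mono h0 _ t)
  have hpos := exp_sub_one_pos
  have hc : Continuous fun ε : ℝ≥0 => 1 / (Real.exp 1 - 1) *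
      (J - Real.exp ε * (Real.exp 1 * F x) + F y * (Real.exp 1 - Real.exp ε)) := by fun_prop
  have hlim := (hc.tendsto 0).mono_left (nhdsWithin_le_nhds (s := Set.Ioi 0))
  have hval : 1 / (Real.exp 1 - 1) *
      (J - Real.exp (0 : ℝ≥0) * (Real.exp 1 * F x) + F y * (Real.exp 1 - Real.exp (0 : ℝ≥0))) =
      F y + OCDRA.averaged F x - Real.exp 1 / (Real.exp 1 - 1) * F x := by
    rw [OCDRA.averaged, ← hJ, NNReal.coe_zero, Real.exp_zero]
    field_simp
    ring
  rw [hval] at hlim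
  refine le_of_tendsto hlim ?_
  filter_upwards [Ioc_mem_nhdsGT (zero_lt_one' ℝ≥0)] with ε hε
  have hε' : (0 : ℝ) < ε := hε.1
  -- By concavity the directional derivative is above every difference quotient, so only the
  -- explicit lower bound has to pass to the limit.
  have h1 := ((h.averaged h0).grad x).sub_le (h.averaged h0).concave (ε • y)
  have h2 := add_le_averaged_shift h.concave h.mono h0 x y hε.2
  have hsum : ∑ a, averagedGrad G x a * (((ε • y) a : ℝ≥0) : ℝ) =
      ε * ∑ a, averagedGrad G x a * (y a : ℝ) := by
    rw [Finset.mul_sum]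
    refine Finset.sum_congr rfl fun a _ => ?_
    simp only [Pi.smul_apply, smul_eq_mul, NNReal.coe_mul]
    ring
  rw [hsum] at h1
  refine le_of_mul_le_mul_left (le_trans ?_ h1) hε'
  rw [OCDRA.averaged, OCDRA.averaged, ← mul_sub, ← hJ, mul_left_comm]
  refine mul_le_mul_of_nonneg_left ?_ inv_exp_sub_one_nonneg
  rw [← hJ] at h2
  -- The growth `exp ε - 1 ≥ ε` of the shift factor contributes the full integral `J`.
  have h3 := mul_le_mul_of_nonneg_right (Real.add_one_le_exp (ε : ℝ)) hJ0
  linarith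

/-- Substituting `s = μt` bounds the integral at `x/μ` by the integral for `x` over `[0, μ]`; the
excess over `[1, μ]` is controlled by `G 0`. This is the upper half of the continuity of the
averaged gradient. -/
lemma averagedGrad_shrink_le (h : HasAntitoneGradient F G) (x : ι → ℝ≥0) (a : ι) {μ : ℝ≥0}
    (hμ : 1 ≤ μ) : averagedGrad G (μ⁻¹ • x) a ≤ averagedGrad G x a +
      1 / (Real.exp 1 - 1) * ((Real.exp μ - Real.exp 1) * G 0 a) := by
  have hμ' : (1 : ℝ) ≤ μ := hμ
  have hμ0 : (0 : ℝ) < μ := zero_lt_one.trans_le hμ'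
  have hi := fun b c hb hc => h.intervalIntegrable_exp_mul x a (b := b) (c := c) hb hc
  rw [averagedGrad, averagedGrad, ← mul_add]
  refine mul_le_mul_of_nonneg_left ?_ inv_exp_sub_one_nonneg
  have hpt : ∫ t in (0 : ℝ)..1, Real.exp t * G ((Real.toNNReal t)⁻¹ • μ⁻¹ • x) a ≤
      ∫ t in (0 : ℝ)..1, μ * (Real.exp (μ * t) * G ((Real.toNNReal (μ * t))⁻¹ • x) a) := by
    have hr : IntervalIntegrable
        (fun t : ℝ => Real.exp (μ * t) * G ((Real.toNNReal (μ * t))⁻¹ • x) a) volume 0 1 := by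
      have := (hi 0 μ le_rfl μ.2).comp_mul_left (c := (μ : ℝ))
      simpa [hμ0.ne'] using this
    refine intervalIntegral.integral_mono_on zero_le_one
      (h.intervalIntegrable_exp_mul _ a le_rfl zero_le_one) (hr.const_mul _) fun t ht => ?_
    have hn := h.nonneg ((Real.toNNReal (μ * t))⁻¹ • x) a
    have e : (Real.toNNReal t)⁻¹ • μ⁻¹ • x = (Real.toNNReal (μ * t))⁻¹ • x := by
      rw [smul_smul, Real.toNNReal_mul (NNReal.coe_nonneg μ), Real.toNNReal_coe, mul_inv_rev]
    rw [e, ← mul_assoc]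
    refine mul_le_mul_of_nonneg_right ?_ hn
    have h1 : Real.exp t ≤ Real.exp (μ * t) :=
      Real.exp_le_exp.2 (le_mul_of_one_le_left ht.1 hμ')
    exact h1.trans (le_mul_of_one_le_left (Real.exp_pos _).le hμ')
  refine hpt.trans ?_
  rw [intervalIntegral.integral_const_mul, intervalIntegral.mul_integral_comp_mul_left
    (f := fun s => Real.exp s * G ((Real.toNNReal s)⁻¹ • x) a), mul_zero, mul_one,
    ← intervalIntegral.integral_add_adjacent_intervals (hi 0 1 le_rfl zero_le_one)
      (hi 1 μ zero_le_one μ.2)]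
  gcongr
  have : ∫ s in (1 : ℝ)..μ, Real.exp s * G ((Real.toNNReal s)⁻¹ • x) a ≤
      ∫ s in (1 : ℝ)..μ, Real.exp s * G 0 a := by
    refine intervalIntegral.integral_mono_on hμ' (hi 1 μ zero_le_one μ.2)
      ((Real.continuous_exp.mul continuous_const).intervalIntegrable _ _) fun t _ => ?_
    exact mul_le_mul_of_nonneg_left (h.le_zero _ _) (Real.exp_pos t).le
  rwa [intervalIntegral.integral_mul_const, integral_exp] at this

/-- Lower semicontinuity: a difference quotient with fixed step is continuous in the base point and,
by concavity, lies below the gradient there. -/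
lemma eventually_lt_grad (h : HasAntitoneGradient F G) (x : ι → ℝ≥0) (a : ι) {c : ℝ}
    (hc : c < G x a) : ∀ᶠ x' in 𝓝 x, c < G x' a := by
  classical
  obtain ⟨ε, hε, hε0⟩ := (((h.grad x).tendsto_single a |>.eventually (lt_mem_nhds hc)).and
    self_mem_nhdsWithin).exists
  have hε' : (0 : ℝ) < ε := hε0
  have hcont : Continuous fun x' : ι → ℝ≥0 => (F (x' + ε • Pi.single a 1) - F x') / (ε : ℝ) := by
    have := h.continuous
    fun_prop
  filter_upwards [(hcont.tendsto x).eventually (lt_mem_nhds hε)] with x' hx'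
  have h1 := (h.grad x').sub_le h.concave (ε • Pi.single a 1)
  rw [Finset.sum_eq_single a (by simp +contextual) (by simp)] at h1
  simp only [Pi.smul_apply, Pi.single_eq_same, smul_eq_mul, mul_one] at h1
  exact hx'.trans_le ((div_le_iff₀ hε').2 h1)

/-- Upper semicontinuity uses that points near `x` dominate `x/μ` for `μ > 1`: zero coordinates
impose nothing, and positive ones shrink strictly. Antitonicity and the scaling estimate then apply
as `μ` tends to `1`. -/
lemma continuous_averagedGrad (h : HasAntitoneGradient F G) (h0 : F 0 = 0) (a : ι) :
    Continuous fun x => averagedGrad G x a := by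
  refine continuous_iff_continuousAt.2 fun x => ?_
  refine tendsto_order.2 ⟨fun c hc => (h.averaged h0).eventually_lt_grad x a hc, fun c hc => ?_⟩
  have hcont : Continuous fun μ : ℝ≥0 => averagedGrad G x a +
      1 / (Real.exp 1 - 1) * ((Real.exp μ - Real.exp 1) * G 0 a) := by fun_prop
  have hlt : ∀ᶠ μ : ℝ≥0 in 𝓝[>] 1, averagedGrad G x a +
      1 / (Real.exp 1 - 1) * ((Real.exp μ - Real.exp 1) * G 0 a) < c := by
    refine (hcont.tendsto 1).mono_left nhdsWithin_le_nhds |>.eventually (gt_mem_nhds ?_)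
    simpa using hc
  have : (𝓝[>] (1 : ℝ≥0)).NeBot := nhdsGT_neBot 1
  obtain ⟨μ, hμ, hμ1⟩ := (hlt.and self_mem_nhdsWithin).exists
  have hμ1' : 1 < μ := hμ1
  have hev : ∀ᶠ x' in 𝓝 x, μ⁻¹ • x ≤ x' := by
    refine eventually_all.2 fun b => ?_
    rcases eq_or_ne (x b) 0 with hb | hb
    · exact Eventually.of_forall fun x' => by simp [hb]
    · have : μ⁻¹ * x b < x b :=
        mul_lt_of_lt_one_left (pos_iff_ne_zero.2 hb) (inv_lt_one_of_one_lt₀ hμ1')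
      have := (continuous_apply b).tendsto x |>.eventually (lt_mem_nhds this)
      filter_upwards [this] with x' hx' using hx'.le
  filter_upwards [hev] with x' hx'
  exact (h.averagedGrad_antitone hx' a).trans_lt
    ((h.averagedGrad_shrink_le x a hμ1'.le).trans_lt hμ)

end HasAntitoneGradient

/-! ### Growth of the potential during one phase -/

section GreedyPhase

variable {ι : Type*} [Fintype ι] {U : (ι → ℝ≥0) → ℝ} {G : (ι → ℝ≥0) → ι → ℝ} {S : Finset ι}
  {x₀ x₁ : ι → ℝ≥0}

lemma HasAntitoneGradient.mem_greedyChoices (h : HasAntitoneGradient U G) {x : ι → ℝ≥0} {a : ι} :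
    a ∈ greedyChoices U S x ↔ a ∈ S ∧ ∀ b ∈ S, G x b ≤ G x a := by
  refine and_congr_right fun _ => ⟨?_, fun hb => ⟨G x, h.grad x, hb⟩⟩
  rintro ⟨g, hg, hb⟩
  rwa [hg.unique (h.grad x)] at hb

/-- A greedy phase in integrated form. -/
lemma IsGreedyPhase.exists_path (hp : IsGreedyPhase U S x₀ x₁) :
    ∃ z : ℝ → ι → ℝ≥0, z 0 = x₀ ∧ z 1 = x₁ ∧
      ContinuousOn z (Set.Icc 0 1) ∧ MonotoneOn z (Set.Icc 0 1) ∧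
      (∀ s t, 0 ≤ s → s ≤ t → t ≤ 1 → ∀ a,
        (∀ τ ∈ Set.Ioc s t, a ∉ greedyChoices U S (z τ)) → z t a = z s a) ∧
      (S.Nonempty → ∀ s t, 0 ≤ s → s ≤ t → t ≤ 1 → ∑ a ∈ S, ((z t a : ℝ) - z s a) = t - s) := by
  obtain ⟨z, r, h0, h1, hint, hz, hae⟩ := hp
  have hint' : ∀ s t, 0 ≤ s → s ≤ t → t ≤ 1 → ∀ a,
      IntervalIntegrable (fun τ => r τ a) volume s t := fun s t hs hst ht a =>
    (hint a).mono_set (by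
      rw [Set.uIcc_of_le hst, Set.uIcc_of_le zero_le_one]
      exact Set.Icc_subset_Icc hs ht)
  have hae' : ∀ s t, 0 ≤ s → s ≤ t → t ≤ 1 → ∀ᵐ τ, τ ∈ Set.uIoc s t →
      (∀ a, 0 ≤ r τ a) ∧ (S.Nonempty → ∑ a ∈ S, r τ a = 1) ∧
      (∀ a, r τ a ≠ 0 → a ∈ greedyChoices U S (z τ)) := fun s t hs hst ht => by
    rw [ae_restrict_iff' measurableSet_Icc] at hae
    filter_upwards [hae] with τ hτ hmem
    rw [Set.uIoc_of_le hst] at hmem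
    exact hτ ⟨hs.trans hmem.1.le, hmem.2.trans ht⟩
  have hdiff : ∀ s t, 0 ≤ s → s ≤ t → t ≤ 1 → ∀ a,
      (z t a : ℝ) - z s a = ∫ τ in s..t, r τ a := fun s t hs hst ht a => by
    rw [hz t ⟨hs.trans hst, ht⟩ a, hz s ⟨hs, hst.trans ht⟩ a,
      ← intervalIntegral.integral_add_adjacent_intervals (hint' 0 s le_rfl hs (hst.trans ht) a)
        (hint' s t hs hst ht a)]
    ring
  refine ⟨z, h0, h1, ?_, ?_, ?_, ?_⟩
  · refine continuousOn_pi.2 fun a => ?_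
    have hc : ContinuousOn (fun t => Real.toNNReal ((x₀ a : ℝ) + ∫ s in (0 : ℝ)..t, r s a))
        (Set.Icc 0 1) := by
      refine continuous_real_toNNReal.comp_continuousOn (continuousOn_const.add ?_)
      have := intervalIntegral.continuousOn_primitive_interval (μ := volume)
        (f := fun s => r s a) (a := 0) (b := 1)
        (by rw [Set.uIcc_of_le zero_le_one]
            exact (intervalIntegrable_iff_integrableOn_Icc_of_le zero_le_one).1 (hint a))
      rwa [Set.uIcc_of_le zero_le_one] at this
    refine hc.congr fun t ht => ?_
    simp only [← hz t ht a, Real.toNNReal_coe]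
  · intro s hs t ht hst a
    have hnn : 0 ≤ ∫ τ in s..t, r τ a := by
      refine intervalIntegral.integral_nonneg_of_ae_restrict hst ?_
      refine ae_restrict_of_ae_restrict_of_subset (Set.Icc_subset_Icc hs.1 ht.2) ?_
      filter_upwards [hae] with τ hτ using hτ.1 a
    rw [← hdiff s t hs.1 hst ht.2 a] at hnn
    exact_mod_cast sub_nonneg.1 hnn
  · intro s t hs hst ht a ha
    have : ∫ τ in s..t, r τ a = 0 := by
      refine intervalIntegral.integral_zero_ae ?_
      filter_upwards [hae' s t hs hst ht] with τ hτ hmem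
      by_contra hne
      refine ha τ ?_ ((hτ hmem).2.2 a hne)
      rwa [Set.uIoc_of_le hst] at hmem
    rw [← hdiff s t hs hst ht a] at this
    exact_mod_cast sub_eq_zero.1 this
  · intro hS s t hs hst ht
    rw [Finset.sum_congr rfl fun a _ => hdiff s t hs hst ht a,
      ← intervalIntegral.integral_finsetSum fun a _ => hint' s t hs hst ht a]
    have : ∫ τ in s..t, ∑ a ∈ S, r τ a = ∫ τ in s..t, (1 : ℝ) := by
      refine intervalIntegral.integral_congr_ae ?_
      filter_upwards [hae' s t hs hst ht] with τ hτ hmem using (hτ hmem).2.1 hS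
    rw [this]
    simp

lemma IsGreedyPhase.le (hp : IsGreedyPhase U S x₀ x₁) : x₀ ≤ x₁ := by
  obtain ⟨z, rfl, rfl, -, hm, -⟩ := hp.exists_path
  exact hm (by simp) (by simp) zero_le_one

lemma IsGreedyPhase.eq_of_notMem (hp : IsGreedyPhase U S x₀ x₁) {a : ι} (ha : a ∉ S) :
    x₁ a = x₀ a := by
  obtain ⟨z, rfl, rfl, -, -, hoff, -⟩ := hp.exists_path
  exact hoff 0 1 le_rfl zero_le_one le_rfl a fun τ _ h => ha h.1

lemma IsGreedyPhase.sum_sub (hp : IsGreedyPhase U S x₀ x₁) (hS : S.Nonempty) :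
    ∑ a ∈ S, ((x₁ a : ℝ) - x₀ a) = 1 := by
  obtain ⟨z, rfl, rfl, -, -, -, hsum⟩ := hp.exists_path
  simpa using hsum hS 0 1 le_rfl zero_le_one le_rfl

/-- During a greedy phase the potential grows at least by the linearized value, at any later
point, of any way of splitting the item. -/
lemma IsGreedyPhase.sum_le_sub (hp : IsGreedyPhase U S x₀ x₁) (hU : HasAntitoneGradient U G)
    {w : ι → ℝ≥0} (hw : x₁ ≤ w) {y : ι → ℝ≥0} (hy : ∑ a ∈ S, y a ≤ 1) :
    ∑ a ∈ S, G w a * (y a : ℝ) ≤ U x₁ - U x₀ := by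
  rcases S.eq_empty_or_nonempty with rfl | hS
  · simpa using hU.mono hp.le
  obtain ⟨b, hb, hmax⟩ := S.exists_max_image (G w) hS
  have hM : ∑ a ∈ S, G w a * (y a : ℝ) ≤ G w b := by
    have hy' : ∑ a ∈ S, (y a : ℝ) ≤ 1 := by exact_mod_cast hy
    calc ∑ a ∈ S, G w a * (y a : ℝ) ≤ ∑ a ∈ S, G w b * (y a : ℝ) :=
          Finset.sum_le_sum fun a ha => mul_le_mul_of_nonneg_right (hmax a ha) (y a).2
      _ = G w b * ∑ a ∈ S, (y a : ℝ) := (Finset.mul_sum _ _ _).symm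
      _ ≤ G w b := mul_le_of_le_one_right (hU.nonneg w b) hy'
  refine hM.trans ?_
  obtain ⟨z, rfl, rfl, hcont, hmono, hoff, hsum⟩ := hp.exists_path
  set M := G w b
  have hchoice : ∀ τ ∈ Set.Icc (0 : ℝ) 1, ∀ a, a ∈ greedyChoices U S (z τ) → M ≤ G (z τ) a := by
    intro τ hτ a ha
    have hle : z τ ≤ w := (hmono hτ (by simp) hτ.2).trans hw
    exact (hU.antitone hle b).trans ((hU.mem_greedyChoices.1 ha).2 b hb)
  have hclosed : IsClosed ({t | U (z 0) + M * t ≤ U (z t)} ∩ Set.Icc (0 : ℝ) 1) := by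
    rw [Set.inter_comm]
    exact isClosed_Icc.isClosed_le (by fun_prop)
      (hU.continuous.comp_continuousOn hcont)
  -- Continuous induction on `U (z t) ≥ U (z 0) + M t`, which avoids differentiating `U` along the
  -- path.
  have hsub := hclosed.Icc_subset_of_forall_mem_nhdsWithin (by simp) ?_
  · have := hsub (show (1 : ℝ) ∈ Set.Icc 0 1 by simp)
    simp only [Set.mem_ofPred_eq, mul_one] at this
    linarith
  rintro t ⟨ht, ht0, ht1⟩
  -- If the partial derivative at `a` is at least `M` at some later time, it is so at all earlier
  -- times by antitonicity. Otherwise `a` is never chosen after `t`, since chosen options have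
  -- derivative at least `M`, and its coordinate is frozen.
  have hev : ∀ᶠ s in 𝓝[>] t, ∀ a, M ≤ G (z s) a ∨ z s a = z t a := by
    refine eventually_all.2 fun a => ?_
    by_cases hex : ∃ τ ∈ Set.Ioc t 1, M ≤ G (z τ) a
    · obtain ⟨τ, hτ, hle⟩ := hex
      filter_upwards [Ioc_mem_nhdsGT hτ.1] with s hs
      left
      exact hle.trans (hU.antitone (hmono ⟨ht0.trans hs.1.le, hs.2.trans hτ.2⟩
        ⟨ht0.trans hτ.1.le, hτ.2⟩ hs.2) a)
    · filter_upwards [Ioc_mem_nhdsGT ht1] with s hs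
      right
      refine hoff t s ht0 hs.1.le hs.2 a fun τ hτ hmem => hex ⟨τ, ⟨hτ.1, hτ.2.trans hs.2⟩, ?_⟩
      exact hchoice τ ⟨ht0.trans hτ.1.le, hτ.2.trans hs.2⟩ a hmem
  filter_upwards [hev, Ioc_mem_nhdsGT ht1] with s hs hs1
  have hle : z t ≤ z s := hmono ⟨ht0, ht1.le⟩ ⟨ht0.trans hs1.1.le, hs1.2⟩ hs1.1.le
  have hgrow : ∑ a, G (z s) a * ((z s - z t) a : ℝ) ≤ U (z s) - U (z t) := by
    have e : z t + (z s - z t) = z s := add_tsub_cancel_of_le hle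
    have := (e.symm ▸ hU.grad (z s) : IsUpwardGradient U (z t + (z s - z t)) (G (z s))).le_sub
      hU.concave
    rwa [e] at this
  have hlow : M * (s - t) ≤ ∑ a, G (z s) a * ((z s - z t) a : ℝ) := by
    rw [← hsum hS t s ht0 hs1.1.le hs1.2, Finset.mul_sum]
    refine (Finset.sum_le_sum fun a _ => ?_).trans
      (Finset.sum_le_sum_of_subset_of_nonneg (Finset.subset_univ S) fun a _ _ =>
        mul_nonneg (hU.nonneg _ _) ((z s - z t) a).2)
    rw [Pi.sub_apply, NNReal.coe_sub (hle a)]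
    rcases hs a with h | h
    · exact mul_le_mul_of_nonneg_right h (sub_nonneg.2 (hle a))
    · simp [h]
  simp only [Set.mem_ofPred_eq] at ht ⊢
  linarith

end GreedyPhase

/-! ### Telescoping over the items and the competitive ratio -/

section Competitive

variable {α : Type*} [DecidableEq α] {I : Data α} {x : I.Opt → ℝ≥0}

lemma Data.mem_optionSet {j : Fin I.n} {a : I.Opt} : a ∈ I.optionSet j ↔ a.1 ∈ I.options j := by
  simp [Data.optionSet]

lemma Data.exists_mem_optionSet (a : I.Opt) : ∃ j, a ∈ I.optionSet j := by
  obtain ⟨j, -, hj⟩ := Finset.mem_biUnion.1 a.2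
  exact ⟨j, Data.mem_optionSet.2 hj⟩

lemma Data.IsOCDRA.eq_of_mem (hI : I.IsOCDRA) {i j : Fin I.n} {a : I.Opt}
    (hi : a ∈ I.optionSet i) (hj : a ∈ I.optionSet j) : i = j := by
  by_contra hne
  exact Finset.disjoint_left.1 (hI.disjoint i j hne) (Data.mem_optionSet.1 hi)
    (Data.mem_optionSet.1 hj)

lemma Data.IsOCDRA.sum_eq (hI : I.IsOCDRA) (u : I.Opt → ℝ) :
    ∑ a, u a = ∑ j, ∑ a ∈ I.optionSet j, u a := by
  classical
  rw [← Finset.sum_biUnion fun i _ j _ hij =>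
    Finset.disjoint_left.2 fun a hi hj => hij (hI.eq_of_mem hi hj)]
  refine Finset.sum_congr (Finset.ext fun a => ?_) fun _ _ => rfl
  simpa using Data.exists_mem_optionSet a

/-- The part of an allocation made on the first `k` items. -/
noncomputable def Data.firstItems (I : Data α) (k : ℕ) (x : I.Opt → ℝ≥0) : I.Opt → ℝ≥0 :=
  Set.indicator {a | ∃ i : Fin I.n, i.1 < k ∧ a ∈ I.optionSet i} x

lemma Data.before_eq (j : Fin I.n) : I.before j x = I.firstItems j x := rfl

lemma Data.upTo_eq (j : Fin I.n) : I.upTo j x = I.firstItems (j + 1) x := by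
  simp only [Data.upTo, Data.firstItems, Nat.lt_succ_iff, Fin.le_def]

lemma Data.firstItems_zero : I.firstItems 0 x = 0 := by
  funext a
  simp [Data.firstItems]

lemma Data.firstItems_n : I.firstItems I.n x = x := by
  refine Set.indicator_eq_self.2 fun a _ => ?_
  obtain ⟨j, hj⟩ := Data.exists_mem_optionSet a
  exact ⟨j, j.2, hj⟩

lemma Data.upTo_le (j : Fin I.n) : I.upTo j x ≤ x :=
  Set.indicator_le_self' fun _ _ => zero_le

lemma Data.upTo_of_mem {j : Fin I.n} {a : I.Opt} (ha : a ∈ I.optionSet j) :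
    I.upTo j x a = x a :=
  Set.indicator_of_mem (s := {a | ∃ i : Fin I.n, i ≤ j ∧ a ∈ I.optionSet i}) ⟨j, le_rfl, ha⟩ x

lemma Data.IsOCDRA.before_of_mem (hI : I.IsOCDRA) {j : Fin I.n} {a : I.Opt}
    (ha : a ∈ I.optionSet j) : I.before j x a = 0 := by
  refine Set.indicator_of_notMem ?_ x
  rintro ⟨i, hij, hi⟩
  exact hij.ne (hI.eq_of_mem hi ha)

lemma IsContinuousGreedyOutput.isFeasible (hI : I.IsOCDRA) {U : (I.Opt → ℝ≥0) → ℝ}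
    (hx : IsContinuousGreedyOutput I U x) : I.IsFeasible x := by
  intro j
  rcases (I.optionSet j).eq_empty_or_nonempty with h | h
  · simp [h]
  have hs := (hx j).sum_sub h
  have : ∑ a ∈ I.optionSet j, (x a : ℝ) = 1 := by
    rw [← hs]
    refine Finset.sum_congr rfl fun a ha => ?_
    rw [Data.upTo_of_mem ha, hI.before_of_mem ha]
    simp
  exact le_of_eq (by exact_mod_cast this)

/-- The gradient is evaluated at the final allocation in every phase, which lies above each phase's
end, so the phase bounds add up while the potential telescopes. -/
lemma IsContinuousGreedyOutput.sum_le (hI : I.IsOCDRA) {U : (I.Opt → ℝ≥0) → ℝ}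
    {G : (I.Opt → ℝ≥0) → I.Opt → ℝ} (hU : HasAntitoneGradient U G) (h0 : U 0 = 0)
    (hx : IsContinuousGreedyOutput I U x) {y : I.Opt → ℝ≥0} (hy : I.IsFeasible y) :
    ∑ a, G x a * (y a : ℝ) ≤ U x := by
  rw [hI.sum_eq]
  have htel : ∑ j : Fin I.n, (U (I.upTo j x) - U (I.before j x)) = U x := by
    simp only [Data.upTo_eq, Data.before_eq]
    rw [Fin.sum_univ_eq_sum_range
      (fun k => U (I.firstItems (k + 1) x) - U (I.firstItems k x)) I.n,
      Finset.sum_range_sub (fun k => U (I.firstItems k x)), Data.firstItems_n,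
      Data.firstItems_zero, h0, sub_zero]
  rw [← htel]
  exact Finset.sum_le_sum fun j _ => (hx j).sum_le_sub hU (Data.upTo_le j) (hy j)

lemma IsContinuousGreedyOutput.competitive (hI : I.IsOCDRA)
    (hx : IsContinuousGreedyOutput I (auxiliary I.f) x) {y : I.Opt → ℝ≥0} (hy : I.IsFeasible y) :
    (1 - 1 / Real.exp 1) * (I.f y : ℝ) ≤ I.f x := by
  obtain ⟨G, hG⟩ := hI.cdr.exists_hasAntitoneGradient
  have h0 : ((I.f 0 : ℝ≥0) : ℝ) = 0 := by simp [hI.cdr.map_zero]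
  have h1 := hx.sum_le hI (hG.averaged h0) (averaged_zero h0) hy
  have h2 := hG.le_sum_averagedGrad h0 x y
  have h3 : (I.f y : ℝ) ≤ Real.exp 1 / (Real.exp 1 - 1) * I.f x := by linarith
  have hpos := exp_sub_one_pos
  have he := Real.exp_pos 1
  rw [div_mul_eq_mul_div, le_div_iff₀ hpos] at h3
  have e : (1 - 1 / Real.exp 1) * (I.f y : ℝ) = I.f y * (Real.exp 1 - 1) / Real.exp 1 := by
    field_simp
  rw [e, div_le_iff₀ he]
  linarith

end Competitive

/-! ### Existence of greedy phases by discretization -/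

section Euler

variable {ι : Type*} [DecidableEq ι]

/-- Iterates of the discretized greedy process with step size `δ`. -/
noncomputable def euler (δ : ℝ≥0) (pick : (ι → ℝ≥0) → ι) (x₀ : ι → ℝ≥0) : ℕ → ι → ℝ≥0
  | 0 => x₀
  | k + 1 => euler δ pick x₀ k + Pi.single (pick (euler δ pick x₀ k)) δ

variable (δ : ℝ≥0) (pick : (ι → ℝ≥0) → ι) (x₀ : ι → ℝ≥0)

lemma euler_mono : Monotone (euler δ pick x₀) :=
  monotone_nat_of_le_succ fun _ => le_self_add

lemma euler_add_le (k m : ℕ) (a : ι) :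
    euler δ pick x₀ (k + m) a ≤ euler δ pick x₀ k a + m * δ := by
  induction m with
  | zero => simp
  | succ m ih =>
    have h : (Pi.single (pick (euler δ pick x₀ (k + m))) δ : ι → ℝ≥0) a ≤ δ := by
      rw [Pi.single_apply]
      split_ifs <;> simp
    calc euler δ pick x₀ (k + m) a + (Pi.single (pick (euler δ pick x₀ (k + m))) δ : ι → ℝ≥0) a
        ≤ euler δ pick x₀ k a + m * δ + δ := add_le_add ih h
      _ = _ := by push_cast; ring

lemma euler_eq_of_pick_ne {k l : ℕ} (hkl : k ≤ l) {a : ι}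
    (h : ∀ i, k ≤ i → i < l → pick (euler δ pick x₀ i) ≠ a) :
    euler δ pick x₀ l a = euler δ pick x₀ k a := by
  induction l, hkl using Nat.le_induction with
  | base => rfl
  | succ l hkl ih =>
    rw [euler, Pi.add_apply, Pi.single_eq_of_ne (h l hkl l.lt_succ_self).symm, add_zero]
    exact ih fun i hi hil => h i hi (hil.trans l.lt_succ_self)

lemma sum_euler {S : Finset ι} (hpick : ∀ x, pick x ∈ S) (k : ℕ) :
    ∑ a ∈ S, euler δ pick x₀ k a = ∑ a ∈ S, x₀ a + k * δ := by
  induction k with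
  | zero => simp [euler]
  | succ k ih =>
    simp only [euler, Pi.add_apply, Finset.sum_add_distrib, ih]
    rw [Finset.sum_pi_single', if_pos (hpick _)]
    push_cast
    ring

/-- The discretized greedy process as a step function of time, with `n + 1` steps per unit. -/
noncomputable def eulerPath (pick : (ι → ℝ≥0) → ι) (x₀ : ι → ℝ≥0) (n : ℕ) (t : ℝ) : ι → ℝ≥0 :=
  euler ((n : ℝ≥0) + 1)⁻¹ pick x₀ ⌊t * (n + 1)⌋₊

lemma floor_mul_le_floor_mul (n : ℕ) {s t : ℝ} (hst : s ≤ t) :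
    ⌊s * (n + 1)⌋₊ ≤ ⌊t * (n + 1)⌋₊ :=
  Nat.floor_le_floor (mul_le_mul_of_nonneg_right hst (by positivity))

lemma eulerPath_mono (n : ℕ) : Monotone (eulerPath pick x₀ n) := fun _ _ hst =>
  euler_mono _ _ _ (floor_mul_le_floor_mul n hst)

/-- At most `(t - s)(n + 1) + 1` steps of size `1/(n + 1)` fall between the two times: a 1-Lipschitz
bound up to a rounding error that vanishes in the limit. -/
lemma eulerPath_le_add (n : ℕ) {s t : ℝ} (hst : s ≤ t) (a : ι) :
    (eulerPath pick x₀ n t a : ℝ) ≤ eulerPath pick x₀ n s a + (t - s) + 1 / ((n : ℝ) + 1) := by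
  have hN : (0 : ℝ) < (n : ℝ) + 1 := by positivity
  obtain ⟨m, hm⟩ := Nat.exists_eq_add_of_le (floor_mul_le_floor_mul n hst)
  have h := euler_add_le ((n : ℝ≥0) + 1)⁻¹ pick x₀ ⌊s * (n + 1)⌋₊ m a
  rw [← hm] at h
  have h' : (eulerPath pick x₀ n t a : ℝ) ≤ eulerPath pick x₀ n s a + m * ((n : ℝ) + 1)⁻¹ := by
    have h'' := NNReal.coe_le_coe.2 h
    push_cast at h''
    exact h''
  have hmle : (m : ℝ) ≤ (t - s) * (n + 1) + 1 := by
    have h1 : (m : ℝ) = ⌊t * (n + 1)⌋₊ - ⌊s * (n + 1)⌋₊ := by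
      rw [hm]; push_cast; ring
    rcases le_total 0 t with ht | ht
    · have h2 := Nat.floor_le (mul_nonneg ht hN.le)
      have h3 := Nat.lt_floor_add_one (s * ((n : ℝ) + 1))
      rw [h1]
      linarith
    · have h2 : ⌊t * ((n : ℝ) + 1)⌋₊ = 0 :=
        Nat.floor_of_nonpos (mul_nonpos_of_nonpos_of_nonneg ht hN.le)
      have h4 : m = 0 := by omega
      have := mul_nonneg (sub_nonneg.2 hst) hN.le
      rw [h4, Nat.cast_zero]
      linarith
  have : m * ((n : ℝ) + 1)⁻¹ ≤ (t - s) + 1 / ((n : ℝ) + 1) := by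
    rw [← div_eq_mul_inv, div_le_iff₀ hN, add_mul, one_div_mul_cancel hN.ne']
    exact hmle
  linarith

lemma tendsto_floor_mul_div {t : ℝ} (ht : 0 ≤ t) :
    Tendsto (fun n : ℕ => (⌊t * ((n : ℝ) + 1)⌋₊ : ℝ) * ((n : ℝ) + 1)⁻¹) atTop (𝓝 t) := by
  have h := (tendsto_nat_floor_mul_div_atTop ht).comp
    (tendsto_atTop_add_const_right atTop (1 : ℝ) tendsto_natCast_atTop_atTop)
  exact h.congr fun n => div_eq_mul_inv _ _

variable [Fintype ι]

/-- Pointwise limits of discretized greedy processes. -/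
lemma exists_greedy_path {G : (ι → ℝ≥0) → ι → ℝ} (hG : ∀ a, Continuous fun x => G x a)
    {S : Finset ι} (hS : S.Nonempty) :
    ∃ z : ℝ → ι → ℝ≥0, z 0 = x₀ ∧ Monotone z ∧
      (∀ s t, s ≤ t → ∀ a, (z t a : ℝ) ≤ z s a + (t - s)) ∧
      (∀ t, 0 ≤ t → ∑ a ∈ S, (z t a : ℝ) = ∑ a ∈ S, (x₀ a : ℝ) + t) ∧
      (∀ t, ∀ a ∉ S, z t a = x₀ a) ∧
      (∀ s a, (∃ b ∈ S, G (z s) a < G (z s) b) → ∀ᶠ τ in 𝓝 s, z τ a = z s a) := by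
  have hex : ∀ x : ι → ℝ≥0, ∃ a ∈ S, ∀ b ∈ S, G x b ≤ G x a := fun x =>
    S.exists_max_image (G x) hS
  choose pick hpick hmax using hex
  -- A single ultrafilter gives limits at all times simultaneously, with no extraction of
  -- subsequences.
  set 𝒰 : Ultrafilter ℕ := hyperfilter ℕ
  have hle : (𝒰 : Filter ℕ) ≤ atTop := by
    rw [← Nat.cofinite_eq_atTop]
    exact hyperfilter_le_cofinite
  have hlim : ∀ t a, ∃ c, Tendsto (fun n => eulerPath pick x₀ n t a) 𝒰 (𝓝 c) := fun t a => by
    set T := max t 0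
    have hmem : ∀ n, eulerPath pick x₀ n t a ∈ Set.Icc 0 (x₀ a + Real.toNNReal T + 1) := by
      intro n
      refine ⟨zero_le, ?_⟩
      have h1 := eulerPath_mono pick x₀ n (le_max_left t 0) a
      have h2 := eulerPath_le_add pick x₀ n (le_max_right t 0) a
      have h3 : eulerPath pick x₀ n 0 a = x₀ a := by simp [eulerPath, euler]
      have h4 : 1 / ((n : ℝ) + 1) ≤ 1 := by
        rw [div_le_one (by positivity)]
        linarith [n.cast_nonneg (α := ℝ)]
      rw [h3, sub_zero] at h2
      rw [← NNReal.coe_le_coe]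
      push_cast
      rw [Real.coe_toNNReal _ (le_max_right t 0)]
      have h1' : (eulerPath pick x₀ n t a : ℝ) ≤ eulerPath pick x₀ n T a := h1
      linarith
    obtain ⟨c, -, hc⟩ := isCompact_Icc.ultrafilter_le_nhds
      (𝒰.map fun n => eulerPath pick x₀ n t a)
      (le_principal_iff.2 (mem_map.2 (univ_mem' hmem)))
    exact ⟨c, hc⟩
  choose z hz using hlim
  have hz' : ∀ t a, Tendsto (fun n => (eulerPath pick x₀ n t a : ℝ)) 𝒰 (𝓝 (z t a)) :=
    fun t a => (NNReal.continuous_coe.tendsto _).comp (hz t a)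
  have hinv : Tendsto (fun n : ℕ => 1 / ((n : ℝ) + 1)) 𝒰 (𝓝 0) :=
    tendsto_one_div_add_atTop_nhds_zero_nat.mono_left hle
  have hmono : Monotone z := fun s t hst a =>
    le_of_tendsto_of_tendsto' (hz s a) (hz t a) fun n => eulerPath_mono pick x₀ n hst a
  have hlip : ∀ s t, s ≤ t → ∀ a, (z t a : ℝ) ≤ z s a + (t - s) := fun s t hst a => by
    have h := ((hz' s a).add_const (t - s)).add hinv
    rw [add_zero] at h
    exact le_of_tendsto_of_tendsto' (hz' t a) h fun n => eulerPath_le_add pick x₀ n hst a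
  refine ⟨z, ?_, hmono, hlip, ?_, ?_, ?_⟩
  · funext a
    refine tendsto_nhds_unique (hz 0 a) ?_
    simp [eulerPath, euler]
  · intro t ht
    have h1 := tendsto_finsetSum S fun a _ => hz' t a
    have h2 := ((tendsto_floor_mul_div ht).mono_left hle).const_add (∑ a ∈ S, (x₀ a : ℝ))
    refine tendsto_nhds_unique h1 (h2.congr fun n => ?_)
    have := sum_euler ((n : ℝ≥0) + 1)⁻¹ pick x₀ hpick ⌊t * (n + 1)⌋₊
    have := congrArg ((↑) : ℝ≥0 → ℝ) this.symm
    push_cast at this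
    exact this
  · intro t a ha
    refine tendsto_nhds_unique (hz t a) (tendsto_const_nhds.congr fun n => ?_)
    exact (euler_eq_of_pick_ne _ pick x₀ (Nat.zero_le _)
      fun i _ _ h => ha (by rw [← h]; exact hpick _)).symm
  · rintro s a ⟨b, hb, hlt⟩
    have hnhds : {w | G w a < G w b} ∈ 𝓝 (z s) :=
      (isOpen_lt (hG a) (hG b)).mem_nhds hlt
    obtain ⟨ε, hε, hball⟩ := Metric.mem_nhds_iff.1 hnhds
    have hnear : ∀ τ ∈ Set.Icc (s - ε / 2) (s + ε / 2), ∀ c, |(z τ c : ℝ) - z s c| < ε := by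
      intro τ hτ c
      rcases le_total s τ with h | h
      · have h1 := hlip s τ h c
        have h2 : (z s c : ℝ) ≤ z τ c := hmono h c
        rw [abs_lt]
        constructor <;> linarith [hτ.2]
      · have h1 := hlip τ s h c
        have h2 : (z τ c : ℝ) ≤ z s c := hmono h c
        rw [abs_lt]
        constructor <;> linarith [hτ.1]
    have hev : ∀ τ ∈ Set.Icc (s - ε / 2) (s + ε / 2),
        ∀ᶠ n in 𝒰, ∀ c, |(eulerPath pick x₀ n τ c : ℝ) - z s c| < ε := fun τ hτ =>
      eventually_all.2 fun c =>
        (((hz' τ c).sub_const _).abs).eventually (gt_mem_nhds (hnear τ hτ c))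
    -- All iterates between the two times are sandwiched coordinatewise between the endpoints, hence
    -- stay in the ball where `b` beats `a`. So `a` is never picked there, and its coordinate is
    -- constant before and after the limit.
    have hconst : ∀ τ₁ ∈ Set.Icc (s - ε / 2) (s + ε / 2), ∀ τ₂ ∈ Set.Icc (s - ε / 2) (s + ε / 2),
        τ₁ ≤ τ₂ → z τ₁ a = z τ₂ a := by
      intro τ₁ h₁ τ₂ h₂ h₁₂
      refine tendsto_nhds_unique_of_eventuallyEq (hz τ₁ a) (hz τ₂ a) ?_
      filter_upwards [hev τ₁ h₁, hev τ₂ h₂] with n hn₁ hn₂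
      refine (euler_eq_of_pick_ne _ pick x₀ (floor_mul_le_floor_mul n h₁₂) fun i hi₁ hi₂ h => ?_).symm
      set w := euler ((n : ℝ≥0) + 1)⁻¹ pick x₀ i with hw
      have hwball : w ∈ Metric.ball (z s) ε := by
        rw [Metric.mem_ball, dist_pi_lt_iff hε]
        intro c
        have hlow : (eulerPath pick x₀ n τ₁ c : ℝ) ≤ w c := euler_mono _ pick x₀ hi₁ c
        have hup : (w c : ℝ) ≤ eulerPath pick x₀ n τ₂ c := euler_mono _ pick x₀ hi₂.le c
        have ha₁ := abs_lt.1 (hn₁ c)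
        have ha₂ := abs_lt.1 (hn₂ c)
        rw [NNReal.dist_eq, abs_lt]
        constructor <;> linarith [ha₁.1, ha₂.2]
      have := hball hwball
      have h' := hmax w b hb
      rw [h] at h'
      exact absurd this (not_lt.2 h')
    have hs : s ∈ Set.Icc (s - ε / 2) (s + ε / 2) := ⟨by linarith, by linarith⟩
    filter_upwards [Icc_mem_nhds (show s - ε / 2 < s by linarith)
      (show s < s + ε / 2 by linarith)] with τ hτ
    rcases le_total τ s with h | h
    · exact hconst τ hτ s hs h
    · exact (hconst s hs τ hτ h).symm

end Euler

/-- Greedy phases exist when the gradient is continuous. -/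
lemma HasAntitoneGradient.exists_isGreedyPhase {ι : Type*} [Fintype ι] {U : (ι → ℝ≥0) → ℝ}
    {G : (ι → ℝ≥0) → ι → ℝ} (hU : HasAntitoneGradient U G) (hG : ∀ a, Continuous fun x => G x a)
    (S : Finset ι) (x₀ : ι → ℝ≥0) : ∃ x₁, IsGreedyPhase U S x₀ x₁ := by
  classical
  rcases S.eq_empty_or_nonempty with rfl | hS
  · exact ⟨x₀, fun _ => x₀, fun _ _ => 0, rfl, rfl, by simp, by simp, by simp⟩
  obtain ⟨z, hz0, hmono, hlip, hsum, hoff, hloc⟩ := exists_greedy_path x₀ hG hS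
  have hmono' : ∀ a, Monotone fun t => (z t a : ℝ) := fun a s t hst => hmono hst a
  have hLip : ∀ a, LipschitzWith 1 fun t => (z t a : ℝ) := fun a => by
    refine LipschitzWith.of_le_add fun s t => ?_
    rcases le_total s t with h | h
    · exact (hmono' a h).trans (le_add_of_nonneg_right dist_nonneg)
    · have := hlip t s h a
      rwa [Real.dist_eq, abs_of_nonneg (sub_nonneg.2 h)]
  have hac : ∀ a b c, AbsolutelyContinuousOnInterval (fun t => (z t a : ℝ)) b c := fun a b c =>
    (hLip a).lipschitzOnWith.absolutelyContinuousOnInterval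
  -- The rates are the almost-everywhere derivatives of the Lipschitz limit path, which absolute
  -- continuity integrates back to the path.
  refine ⟨z 1, z, fun s a => deriv (fun t => (z t a : ℝ)) s, hz0, rfl,
    fun a => (hac a 0 1).intervalIntegrable_deriv, fun t _ a => ?_, ?_⟩
  · rw [(hac a 0 t).integral_deriv_eq_sub, hz0]
    ring
  · have hdiff : ∀ᵐ s, ∀ a, DifferentiableAt ℝ (fun t => (z t a : ℝ)) s :=
      ae_all_iff.2 fun a => (hmono' a).ae_differentiableAt
    -- The mass identity is known only for nonnegative times; excluding `0` makes it hold in a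
    -- neighborhood of `s`.
    have hne : ∀ᵐ s : ℝ, s ≠ 0 := by simp [ae_iff]
    rw [ae_restrict_iff' measurableSet_Icc]
    filter_upwards [hdiff, hne] with s hs hs0 hmem
    have hpos : 0 < s := lt_of_le_of_ne hmem.1 hs0.symm
    refine ⟨fun a => (hmono' a).deriv_nonneg, fun _ => ?_, fun a ha => ?_⟩
    · have h1 : HasDerivAt (fun t => ∑ a ∈ S, (z t a : ℝ))
          (∑ a ∈ S, deriv (fun t => (z t a : ℝ)) s) s :=
        HasDerivAt.fun_sum fun a _ => (hs a).hasDerivAt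
      have h2 : HasDerivAt (fun t => ∑ a ∈ S, (x₀ a : ℝ) + t) 1 s :=
        (hasDerivAt_id s).const_add _
      refine h1.unique (h2.congr_of_eventuallyEq ?_)
      filter_upwards [lt_mem_nhds hpos] with t ht using hsum t ht.le
    · refine hU.mem_greedyChoices.2 ⟨?_, fun b hb => ?_⟩
      · by_contra haS
        refine ha ?_
        simp [hoff _ a haS]
      · by_contra! hlt
        refine ha ?_
        have : (fun t => (z t a : ℝ)) =ᶠ[𝓝 s] fun _ => (z s a : ℝ) := by
          filter_upwards [hloc s a ⟨b, hb, hlt⟩] with τ hτ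
          rw [hτ]
        rw [this.deriv_eq, deriv_const]

lemma IsCDR.exists_isGreedyPhase {ι : Type*} [Fintype ι] {f : (ι → ℝ≥0) → ℝ≥0} (hf : IsCDR f)
    (S : Finset ι) (x₀ : ι → ℝ≥0) : ∃ x₁, IsGreedyPhase (auxiliary f) S x₀ x₁ := by
  obtain ⟨G, hG⟩ := hf.exists_hasAntitoneGradient
  have h0 : ((f 0 : ℝ≥0) : ℝ) = 0 := by simp [hf.map_zero]
  exact (hG.averaged h0).exists_isGreedyPhase (hG.continuous_averagedGrad h0) S x₀

/-! ### Restriction of the objective to revealed coordinates -/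

/-- Extension of a vector by zero along a map of coordinates. -/
noncomputable def extendZero {ι κ : Type*} (e : ι → κ) (x : ι → ℝ≥0) : κ → ℝ≥0 :=
  Function.extend e x 0

section Extend

variable {ι κ : Type*} {e : ι → κ}

lemma extendZero_apply (he : Function.Injective e) (x : ι → ℝ≥0) (a : ι) :
    extendZero e x (e a) = x a := he.extend_apply x 0 a

lemma extendZero_of_notMem (x : ι → ℝ≥0) {b : κ} (hb : ¬∃ a, e a = b) :
    extendZero e x b = 0 := Function.extend_apply' x (0 : κ → ℝ≥0) b hb

lemma extendZero_add (x y : ι → ℝ≥0) :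
    extendZero e (x + y) = extendZero e x + extendZero e y := by
  rw [extendZero, extendZero, extendZero, ← Function.extend_add, add_zero]

lemma extendZero_smul (c : ℝ≥0) (x : ι → ℝ≥0) :
    extendZero e (c • x) = c • extendZero e x := by
  rw [extendZero, extendZero, ← Function.extend_smul, smul_zero]

lemma extendZero_zero : extendZero e (0 : ι → ℝ≥0) = 0 := by
  simpa using extendZero_smul (e := e) 0 (0 : ι → ℝ≥0)

lemma extendZero_mono (he : Function.Injective e) : Monotone (extendZero e) := by
  intro x y hxy b
  by_cases hb : ∃ a, e a = b
  · obtain ⟨a, rfl⟩ := hb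
    rw [extendZero_apply he, extendZero_apply he]
    exact hxy a
  · rw [extendZero_of_notMem x hb]
    exact zero_le

variable [Fintype ι] [Fintype κ]

lemma sum_mul_extendZero (he : Function.Injective e) (g : κ → ℝ) (y : ι → ℝ≥0) :
    ∑ b, g b * (extendZero e y b : ℝ) = ∑ a, g (e a) * (y a : ℝ) := by
  refine (Fintype.sum_of_injective e he _ _ (fun b hb => ?_) fun a => ?_).symm
  · rw [extendZero_of_notMem y (by simpa using hb)]
    simp
  · rw [extendZero_apply he]

lemma IsUpwardGradient.comp_extendZero (he : Function.Injective e) {F : (κ → ℝ≥0) → ℝ}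
    {x : ι → ℝ≥0} {g : κ → ℝ} (hg : IsUpwardGradient F (extendZero e x) g) :
    IsUpwardGradient (fun x => F (extendZero e x)) x fun a => g (e a) := by
  intro y
  have := hg (extendZero e y)
  rw [sum_mul_extendZero he] at this
  refine this.congr fun ε => ?_
  simp only [extendZero_add, extendZero_smul]

lemma IsCDR.comp_extendZero (he : Function.Injective e) {f : (κ → ℝ≥0) → ℝ≥0} (hf : IsCDR f) :
    IsCDR fun x => f (extendZero e x) where
  map_zero := by rw [extendZero_zero, hf.map_zero]
  concave := by
    refine ⟨convex_univ, fun x _ y _ a b ha hb hab => ?_⟩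
    have := hf.concave.2 (Set.mem_univ (extendZero e x)) (Set.mem_univ (extendZero e y)) ha hb hab
    rwa [← extendZero_smul, ← extendZero_smul, ← extendZero_add] at this
  mono := fun _ _ hxy => hf.mono (extendZero_mono he hxy)
  upward_differentiable := fun x => by
    obtain ⟨g, hg⟩ := hf.upward_differentiable (extendZero e x)
    exact ⟨_, hg.comp_extendZero he⟩
  diminishing_returns := fun x y g h hxy hg hh a => by
    obtain ⟨g', hg'⟩ := hf.upward_differentiable (extendZero e x)
    obtain ⟨h', hh'⟩ := hf.upward_differentiable (extendZero e y)
    rw [hg.unique (hg'.comp_extendZero he), hh.unique (hh'.comp_extendZero he)]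
    exact hf.diminishing_returns _ _ g' h' (extendZero_mono he hxy) hg' hh' (e a)

omit [Fintype ι] [Fintype κ] in
lemma auxiliary_comp_extendZero (f : (κ → ℝ≥0) → ℝ≥0) :
    auxiliary (fun x => f (extendZero e x)) = fun x => auxiliary f (extendZero e x) := by
  funext x
  simp only [auxiliary, extendZero_smul]

/-- Uniqueness makes the small gradient the restriction of the large one, so maximizers correspond.
Existence of the large gradient is a hypothesis because being a greedy choice includes it. -/
lemma IsGreedyPhase.extendZero (e : ι ↪ κ) {U : (κ → ℝ≥0) → ℝ}
    (hU : ∀ x, ∃ g, IsUpwardGradient U x g) {S : Finset ι} {x₀ x₁ : ι → ℝ≥0}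
    (h : IsGreedyPhase (fun x => U (extendZero e x)) S x₀ x₁) :
    IsGreedyPhase U (S.map e) (extendZero e x₀) (extendZero e x₁) := by
  obtain ⟨z, r, rfl, rfl, hint, hz, hae⟩ := h
  have hext : ∀ s, (∀ a, Function.extend e (r s) 0 (e a) = r s a) := fun s a =>
    e.injective.extend_apply _ _ a
  have hext0 : ∀ b, (¬∃ a, e a = b) → ∀ s, Function.extend e (r s) 0 b = 0 := fun b hb s =>
    Function.extend_apply' _ _ b hb
  refine ⟨fun t => OCDRA.extendZero e (z t), fun s => Function.extend e (r s) 0, rfl, rfl,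
    fun b => ?_, fun t ht b => ?_, ?_⟩
  · by_cases hb : ∃ a, e a = b
    · obtain ⟨a, rfl⟩ := hb
      simpa only [hext] using hint a
    · simp [hext0 b hb]
  · by_cases hb : ∃ a, e a = b
    · obtain ⟨a, rfl⟩ := hb
      simpa only [hext, extendZero_apply e.injective] using hz t ht a
    · simp [hext0 b hb, extendZero_of_notMem _ hb]
  · filter_upwards [hae] with s hs
    refine ⟨fun b => ?_, fun hS => ?_, fun b hb => ?_⟩
    · by_cases hb : ∃ a, e a = b
      · obtain ⟨a, rfl⟩ := hb
        simpa only [hext] using hs.1 a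
      · rw [hext0 b hb]
    · rw [Finset.sum_map]
      simpa only [hext] using hs.2.1 (Finset.map_nonempty.1 hS)
    · by_cases hb' : ∃ a, e a = b
      · obtain ⟨a, rfl⟩ := hb'
        rw [hext] at hb
        obtain ⟨haS, g, hg, hmax⟩ := hs.2.2 a hb
        obtain ⟨g', hg'⟩ := hU (OCDRA.extendZero e (z s))
        have hgg' := hg.unique (hg'.comp_extendZero e.injective)
        refine ⟨Finset.mem_map_of_mem e haS, g', hg', fun c hc => ?_⟩
        obtain ⟨c, hcS, rfl⟩ := Finset.mem_map.1 hc
        have := hmax c hcS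
        rwa [hgg'] at this
      · exact absurd (hext0 b hb' s) hb

end Extend

/-! ### The online algorithm -/

section Algorithm

variable {α : Type*} [DecidableEq α]

open Classical in
/-- A final vector of some greedy phase started at `x₀`. -/
noncomputable def phaseEnd {ι : Type*} [Fintype ι] (U : (ι → ℝ≥0) → ℝ) (S : Finset ι)
    (x₀ : ι → ℝ≥0) : ι → ℝ≥0 :=
  if h : ∃ x₁, IsGreedyPhase U S x₀ x₁ then h.choose else x₀

lemma IsCDR.isGreedyPhase_phaseEnd {ι : Type*} [Fintype ι] {f : (ι → ℝ≥0) → ℝ≥0} (hf : IsCDR f)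
    (S : Finset ι) (x₀ : ι → ℝ≥0) :
    IsGreedyPhase (auxiliary f) S x₀ (phaseEnd (auxiliary f) S x₀) := by
  have h := hf.exists_isGreedyPhase S x₀
  rw [phaseEnd, dif_pos h]
  exact h.choose_spec

/-- The options of the item that has arrived last. -/
def Data.lastOptions (D : Data α) : Finset D.Opt :=
  Finset.univ.filter fun a => ∃ i : Fin D.n, i.1 + 1 = D.n ∧ a ∈ D.optionSet i

/-- The online algorithm that reconstructs its earlier decisions from the revealed information and
then runs continuous greedy on the current item. -/
noncomputable def continuousGreedy (D : Data α) : α → ℝ≥0 := fun a =>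
  if h : a ∈ Finset.univ.biUnion D.options then
    phaseEnd (auxiliary D.f) D.lastOptions
      -- The guard leaves out the current item and makes the recursion decrease, since `D.reveal i`
      -- has `i + 1` items.
      (fun b => ∑ i : Fin D.n, if i.1 + 1 < D.n then
        if b ∈ D.optionSet i then continuousGreedy (D.reveal i) b.1 else 0 else 0) ⟨a, h⟩
  else 0
termination_by D.n
decreasing_by assumption

/-- The decisions of the algorithm before the last item. -/
noncomputable def Data.earlierGreedy (D : Data α) : D.Opt → ℝ≥0 := fun b =>
  ∑ i : Fin D.n, if i.1 + 1 < D.n then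
    if b ∈ D.optionSet i then continuousGreedy (D.reveal i) b.1 else 0 else 0

lemma continuousGreedy_apply (D : Data α) (a : D.Opt) :
    continuousGreedy D a.1 = phaseEnd (auxiliary D.f) D.lastOptions D.earlierGreedy a := by
  rw [continuousGreedy, dif_pos a.2]
  rfl

variable (I : Data α) (j : Fin I.n)

/-- The options revealed with item `j`, as options of the whole instance. -/
def Data.revealEmb : (I.reveal j).Opt ↪ I.Opt where
  toFun a := ⟨a.1, by
    obtain ⟨i, -, hi⟩ := Finset.mem_biUnion.1 a.2
    exact Finset.mem_biUnion.2 ⟨_, Finset.mem_univ _, hi⟩⟩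
  inj' a b hab := Subtype.ext (congrArg (fun c : I.Opt => c.1) hab)

lemma Data.revealEmb_coe (a : (I.reveal j).Opt) : (I.revealEmb j a).1 = a.1 := rfl

lemma Data.exists_revealEmb_eq {a : I.Opt} :
    (∃ b, I.revealEmb j b = a) ↔ ∃ i : Fin I.n, i ≤ j ∧ a ∈ I.optionSet i := by
  constructor
  · rintro ⟨b, rfl⟩
    obtain ⟨i, -, hi⟩ := Finset.mem_biUnion.1 b.2
    exact ⟨Fin.castLE j.2 i, Nat.lt_succ_iff.1 i.2, Data.mem_optionSet.2 hi⟩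
  · rintro ⟨i, hij, hi⟩
    refine ⟨⟨a.1, Finset.mem_biUnion.2 ⟨⟨i.1, Nat.lt_succ_iff.2 hij⟩, Finset.mem_univ _, ?_⟩⟩, rfl⟩
    exact Data.mem_optionSet.1 hi

lemma Data.reveal_f :
    (I.reveal j).f = fun x => I.f (extendZero (I.revealEmb j) x) := by
  funext x
  change I.f _ = I.f _
  congr 1
  funext a
  split_ifs with h
  · exact (extendZero_apply (I.revealEmb j).injective x ⟨a.1, h⟩).symm
  · refine (extendZero_of_notMem x ?_).symm
    rintro ⟨b, rfl⟩
    exact h b.2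

/-- Makes the reconstruction consistent: a recursive call sees exactly the data that was revealed
when the earlier item arrived. -/
lemma Data.reveal_reveal (i : Fin (I.reveal j).n) :
    (I.reveal j).reveal i = I.reveal (Fin.castLE j.2 i) := by
  refine congrArg (Data.mk (i.1 + 1)
    (fun k => I.options (Fin.castLE (Nat.succ_le_of_lt (Fin.castLE j.2 i).2) k))) ?_
  funext x
  change I.f _ = I.f _
  congr 1
  funext a
  split_ifs with h₁ h₂ h₂
  · exact dif_pos h₂
  · exact dif_neg h₂
  · refine absurd ?_ h₁
    obtain ⟨k, -, hk⟩ := Finset.mem_biUnion.1 h₂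
    exact Finset.mem_biUnion.2 ⟨⟨k.1, k.2.trans_le i.2⟩, Finset.mem_univ _, hk⟩
  · rfl

lemma Data.mem_reveal_optionSet (i : Fin (I.reveal j).n) (b : (I.reveal j).Opt) :
    b ∈ (I.reveal j).optionSet i ↔ I.revealEmb j b ∈ I.optionSet (Fin.castLE j.2 i) := by
  rw [Data.mem_optionSet, Data.mem_optionSet]
  rfl

lemma Data.map_lastOptions : (I.reveal j).lastOptions.map (I.revealEmb j) = I.optionSet j := by
  ext a
  simp only [Finset.mem_map, Data.lastOptions, Finset.mem_filter, Finset.mem_univ, true_and]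
  constructor
  · rintro ⟨b, ⟨i, hi, hb⟩, rfl⟩
    rw [Data.mem_reveal_optionSet] at hb
    have : Fin.castLE j.2 i = j := Fin.ext (Nat.succ_injective hi)
    rwa [this] at hb
  · intro ha
    obtain ⟨b, rfl⟩ := (I.exists_revealEmb_eq j).2 ⟨j, le_rfl, ha⟩
    exact ⟨b, ⟨⟨j.1, j.1.lt_succ_self⟩, rfl, (I.mem_reveal_optionSet j _ b).2 ha⟩, rfl⟩

variable {I}

lemma Data.IsOCDRA.reveal_cdr (hI : I.IsOCDRA) : IsCDR (I.reveal j).f := by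
  rw [Data.reveal_f]
  exact hI.cdr.comp_extendZero (I.revealEmb j).injective

variable {j}

lemma OnlineAlgorithm.output_of_mem (alg : OnlineAlgorithm α) (hI : I.IsOCDRA) {a : I.Opt}
    (ha : a ∈ I.optionSet j) : alg.output I a = alg (I.reveal j) a.1 := by
  rw [OnlineAlgorithm.output, Finset.sum_eq_single j, if_pos ha]
  · exact fun i _ hij => if_neg fun hi => hij (hI.eq_of_mem hi ha)
  · exact fun h => absurd (Finset.mem_univ j) h

lemma Data.IsOCDRA.earlierGreedy_of_mem (hI : I.IsOCDRA) {b : (I.reveal j).Opt} {i : Fin I.n}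
    (hi : I.revealEmb j b ∈ I.optionSet i) :
    (I.reveal j).earlierGreedy b =
      if i < j then continuousGreedy (I.reveal i) b.1 else 0 := by
  have hij : i ≤ j := by
    obtain ⟨i', hi'j, hi'⟩ := (I.exists_revealEmb_eq j).1 ⟨b, rfl⟩
    rwa [hI.eq_of_mem hi hi']
  rw [Data.earlierGreedy, Finset.sum_eq_single (⟨i.1, Nat.lt_succ_iff.2 hij⟩ : Fin (I.reveal j).n)]
  · have hmem := (I.mem_reveal_optionSet j ⟨i.1, Nat.lt_succ_iff.2 hij⟩ b).2 hi
    rw [if_pos hmem, Data.reveal_reveal]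
    exact if_congr Nat.succ_lt_succ_iff rfl rfl
  · intro k _ hk
    have hnot : b ∉ (I.reveal j).optionSet k := fun h => by
      have hki := hI.eq_of_mem ((I.mem_reveal_optionSet j k b).1 h) hi
      exact hk (Fin.ext (show k.1 = i.1 from congrArg Fin.val hki))
    rw [if_neg hnot, ite_self]
  · exact fun h => absurd (Finset.mem_univ _) h

variable (j)

lemma Data.IsOCDRA.extendZero_earlierGreedy (hI : I.IsOCDRA) :
    extendZero (I.revealEmb j) (I.reveal j).earlierGreedy =
      I.before j (OnlineAlgorithm.output continuousGreedy I) := by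
  funext a
  obtain ⟨i, hi⟩ := Data.exists_mem_optionSet a
  have hbefore : I.before j (OnlineAlgorithm.output continuousGreedy I) a =
      if i < j then continuousGreedy (I.reveal i) a.1 else 0 := by
    split_ifs with hij
    · rw [← OnlineAlgorithm.output_of_mem continuousGreedy hI hi]
      exact Set.indicator_of_mem (s := {a | ∃ i : Fin I.n, i < j ∧ a ∈ I.optionSet i})
        ⟨i, hij, hi⟩ _
    · refine Set.indicator_of_notMem ?_ _
      rintro ⟨k, hkj, hk⟩
      exact hij (hI.eq_of_mem hi hk ▸ hkj)
  rw [hbefore]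
  by_cases hij : i ≤ j
  · obtain ⟨b, rfl⟩ := (I.exists_revealEmb_eq j).2 ⟨i, hij, hi⟩
    rw [extendZero_apply (I.revealEmb j).injective, hI.earlierGreedy_of_mem hi]
    rfl
  · rw [if_neg fun h => hij h.le, extendZero_of_notMem]
    rw [I.exists_revealEmb_eq j]
    rintro ⟨k, hkj, hk⟩
    exact hij (hI.eq_of_mem hi hk ▸ hkj)

/-- A phase leaves the coordinates outside the current item unchanged, so on earlier options its
endpoint still shows the reconstructed decisions; on the current item it is the algorithm's answer
by definition. -/
lemma Data.IsOCDRA.extendZero_phaseEnd (hI : I.IsOCDRA) :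
    extendZero (I.revealEmb j) (phaseEnd (auxiliary (I.reveal j).f) (I.reveal j).lastOptions
      (I.reveal j).earlierGreedy) = I.upTo j (OnlineAlgorithm.output continuousGreedy I) := by
  funext a
  by_cases ha : ∃ b, I.revealEmb j b = a
  · obtain ⟨i, hij, hi⟩ := (I.exists_revealEmb_eq j).1 ha
    obtain ⟨b, rfl⟩ := ha
    have hupTo : I.upTo j (OnlineAlgorithm.output continuousGreedy I) (I.revealEmb j b) =
        continuousGreedy (I.reveal i) b.1 := by
      rw [← Data.revealEmb_coe, ← OnlineAlgorithm.output_of_mem continuousGreedy hI hi]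
      exact Set.indicator_of_mem (s := {a | ∃ i : Fin I.n, i ≤ j ∧ a ∈ I.optionSet i})
        ⟨i, hij, hi⟩ _
    rw [extendZero_apply (I.revealEmb j).injective, hupTo]
    rcases hij.lt_or_eq with hlt | rfl
    · have hnot : b ∉ (I.reveal j).lastOptions := fun h => by
        have := Finset.mem_map_of_mem (I.revealEmb j) h
        rw [Data.map_lastOptions] at this
        exact hlt.ne (hI.eq_of_mem hi this)
      rw [((hI.reveal_cdr j).isGreedyPhase_phaseEnd _ _).eq_of_notMem hnot,
        hI.earlierGreedy_of_mem hi, if_pos hlt]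
    · rw [continuousGreedy_apply]
  · rw [extendZero_of_notMem _ ha]
    rw [I.exists_revealEmb_eq j] at ha
    exact (Set.indicator_of_notMem (s := {a | ∃ i : Fin I.n, i ≤ j ∧ a ∈ I.optionSet i}) ha _).symm

lemma isContinuousGreedyOutput_continuousGreedy (hI : I.IsOCDRA) :
    IsContinuousGreedyOutput I (auxiliary I.f)
      (OnlineAlgorithm.output continuousGreedy I) := by
  intro j
  have hphase := (hI.reveal_cdr j).isGreedyPhase_phaseEnd (I.reveal j).lastOptions
    (I.reveal j).earlierGreedy
  rw [← hI.extendZero_earlierGreedy j, ← hI.extendZero_phaseEnd j, ← I.map_lastOptions j]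
  obtain ⟨G, hG⟩ := hI.cdr.exists_hasAntitoneGradient
  have h0 : ((I.f 0 : ℝ≥0) : ℝ) = 0 := by simp [hI.cdr.map_zero]
  refine IsGreedyPhase.extendZero (I.revealEmb j) (fun x => ⟨_, hG.averaged_grad h0 x⟩) ?_
  have haux : auxiliary (I.reveal j).f =
      fun x => auxiliary I.f (extendZero (I.revealEmb j) x) := by
    rw [Data.reveal_f, auxiliary_comp_extendZero]
  rw [haux] at hphase ⊢
  exact hphase

end Algorithm

end OCDRA

theorem theorem1 {α : Type*} [DecidableEq α] :
    (∃ alg : OCDRA.OnlineAlgorithm α,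
      alg.IsCompetitive (1 - 1 / Real.exp 1) ∧
      ∀ I : OCDRA.Data α, I.IsOCDRA →
        OCDRA.IsContinuousGreedyOutput I (OCDRA.auxiliary I.f) (alg.output I)) ∧
    (∀ I : OCDRA.Data α, I.IsOCDRA →
      ∀ x : I.Opt → NNReal,
        OCDRA.IsContinuousGreedyOutput I (OCDRA.auxiliary I.f) x →
        I.IsFeasible x ∧
        ∀ y : I.Opt → NNReal, I.IsFeasible y →
          (1 - 1 / Real.exp 1) * (I.f y : ℝ) ≤ (I.f x : ℝ)) := by
  have hcomp : ∀ I : OCDRA.Data α, I.IsOCDRA → ∀ x : I.Opt → NNReal,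
      OCDRA.IsContinuousGreedyOutput I (OCDRA.auxiliary I.f) x →
      I.IsFeasible x ∧ ∀ y : I.Opt → NNReal, I.IsFeasible y →
        (1 - 1 / Real.exp 1) * (I.f y : ℝ) ≤ (I.f x : ℝ) :=
    fun I hI x hx => ⟨hx.isFeasible hI, fun y hy => hx.competitive hI hy⟩
  refine ⟨⟨OCDRA.continuousGreedy, fun I hI => ?_, fun I hI => ?_⟩, hcomp⟩
  · exact hcomp I hI _ (OCDRA.isContinuousGreedyOutput_continuousGreedy hI)
  · exact OCDRA.isContinuousGreedyOutput_continuousGreedy hI
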